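/- Let $L/F$ be a finite Galois extension of fields whose Galois group $G$ is isomorphic to the quaternion group of order $8$, with generators $\sigma,\tau$ satisfying $\sigma^4=\tau^4=1$, $\sigma^2=\tau^2$, $\sigma\tau=\tau\sigma^{-1}$. Let $\lambda,\rho:G\to\mathrm{Perm}(G)$ be the left and right regular representations, $\lambda(g)[x]=gx$ and $\rho(g)[x]=xg^{-1}$. A subgroup $N\le\mathrm{Perm}(G)$ is regular if $|N|=|G|$, all point stabilisers in $N$ are trivial, and $N$ is transitive on $G$. A Hopf–Galois structure on $L/F$ is a finite-dimensional $F$-Hopf algebra $H$ with an $F$-linear action on $L$ making $L$ an $H$-module algebra, such that the map $L\otimes_F H\to\mathrm{End}_F(L)$, $l\otimes h\mapsto(x\mapsto l\,h(x))$, is bijective; two such structures are identified if there is an isomorphism of Hopf algebras between them that is compatible with the actions on $L$. If $N$ is a regular subgroup of $\mathrm{Perm}(G)$ normalized by $\lambda(G)$, we say that $N$ is the underlying group of a Hopf–Galois structure if that structure is isomorphic to the fixed ring $L[N]^G$, where $G$ acts on $L$ by Galois automorphisms and on $N$ by ${}^g\eta=\lambda(g)\eta\lambda(g)^{-1}$,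 with the Hopf algebra structure inherited from the group algebra $L[N]$ and the action on $L$ given by $\big(\sum_{\eta} c_\eta\eta\big)(x)=\sum_\eta c_\eta\,(\eta^{-1}[1_G])(x)$. The type of the structure is the isomorphism class of $N$. For $s,t\in\{\sigma,\tau,\sigma\tau\}$ with $s\ne t$ let $A_{s,t}=\langle\lambda(s),\rho(t)\rangle\le\mathrm{Perm}(G)$. Then: 1. each $A_{s,t}$ is a regular subgroup of $\mathrm{Perm}(G)$, is normalized by $\lambda(G)$, and is isomorphic to $C_4\times C_2$; 2. there are six such pairs $(s,t)$, and they yield six distinct groups $A_{s,t}$; 3. there are, up to isomorphism, exactly six Hopf–Galois structures of type $C_4\times C_2$ on $L/F$; each of them has exactly one underlying group, which is one of the groups $A_{s,t}$, and each $A_{s,t}$ is the underlying group of exactly one of them up to isomorphism. -/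

import Mathlib

universe u v

noncomputable section

open scoped TensorProduct

namespace HopfGalois

/-! ### Regular subgroups of `Perm(G)` -/

section Groups

variable {G : Type*} [Group G]

/-- The left regular representation `λ : G → Perm(G)`, `λ(g)[x] = g x`. -/
def leftRegular (G : Type*) [Group G] : G →* Equiv.Perm G where
  toFun g := Equiv.mulLeft g
  map_one' := by ext x; simp
  map_mul' g h := by ext x; simp

/-- The right regular representation `ρ : G → Perm(G)`, `ρ(g)[x] = x g⁻¹`. -/
def rightRegular (G : Type*) [Group G] : G →* Equiv.Perm G where
  toFun g := Equiv.mulRight g⁻¹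
  map_one' := by ext x; simp
  map_mul' g h := by ext x; simp [mul_assoc]

/-- A subgroup `N` of `Perm(G)` is regular if `|N| = |G|`, all stabilisers are trivial, and `N`
acts transitively on `G`. -/
structure IsRegular (N : Subgroup (Equiv.Perm G)) : Prop where
  card_eq : Nat.card N = Nat.card G
  eq_one_of_fixes : ∀ η ∈ N, ∀ g : G, η g = g → η = 1
  transitive : ∀ g h : G, ∃ η ∈ N, η g = h

/-- `N` is normalised by `λ(G)`. -/
def IsNormalizedByLeft (N : Subgroup (Equiv.Perm G)) : Prop :=
  (leftRegular G).range ≤ Subgroup.normalizer (N : Set (Equiv.Perm G))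

/-- The action of `g ∈ G` on a subgroup `N` normalised by `λ(G)`: `η ↦ λ(g) η λ(g)⁻¹`. -/
def conjLeft (N : Subgroup (Equiv.Perm G)) (hN : IsNormalizedByLeft N) (g : G) : N ≃* N :=
  Subgroup.normalizerMonoidHom N ⟨leftRegular G g, hN ⟨g, rfl⟩⟩

/-- The subgroup `A_{s,t} = ⟨λ(s), ρ(t)⟩` of `Perm(G)`. -/
def groupA (s t : G) : Subgroup (Equiv.Perm G) :=
  Subgroup.closure {leftRegular G s, rightRegular G t}

end Groups

/-! ### Hopf-Galois structures -/

/-- A Hopf-Galois structure on the field extension `L/F`: a finite-dimensional `F`-Hopf algebra `H`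
with an `F`-linear action on `L` that makes `L` an `H`-module algebra and for which
`j : L ⊗ H → End_F(L)`, `j(l ⊗ h)(x) = l h(x)`, is bijective. (When `L/F` is finite, bijectivity
of `j` makes `H` small enough to have a copy in the universe of `L`.) -/
structure HopfGaloisStructure (F : Type u) (L : Type v) [Field F] [Field L] [Algebra F L] where
  /-- The Hopf algebra. -/
  H : Type v
  [ring : Ring H]
  [hopf : HopfAlgebra F H]
  [finite : FiniteDimensional F H]
  /-- The action of `H` on `L`. -/
  act : H →ₐ[F] Module.End F L
  /-- `h(1) = ε(h) 1`. -/
  act_one : ∀ h : H, act h 1 = algebraMap F L (Coalgebra.counit (R := F) h)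
  /-- `h(x y) = ∑ h₍₁₎(x) h₍₂₎(y)`. -/
  act_mul : ∀ (h : H) (x y : L), act h (x * y) =
    LinearMap.mul' F L
      (TensorProduct.map (act.toLinearMap.flip x) (act.toLinearMap.flip y)
        (Coalgebra.comul (R := F) h))
  /-- The map `j` is bijective. -/
  bijective : Function.Bijective
    (TensorProduct.lift ((LinearMap.mul F (Module.End F L)).compl₁₂
      (Algebra.lmul F L).toLinearMap act.toLinearMap) : L ⊗[F] H → Module.End F L)

attribute [instance] HopfGaloisStructure.ring HopfGaloisStructure.hopf HopfGaloisStructure.finite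

section Structures

variable {F : Type u} {L : Type v} [Field F] [Field L] [Algebra F L]

/-- Two Hopf-Galois structures on `L/F` are identified if there is an isomorphism of Hopf algebras
compatible with the actions on `L`. (Bialgebra isomorphisms of Hopf algebras commute with the
antipodes.) -/
def HopfGaloisStructure.Equivalent (S T : HopfGaloisStructure F L) : Prop :=
  ∃ e : S.H ≃ₐc[F] T.H, ∀ (h : S.H) (x : L), T.act (e h) x = S.act h x

instance HopfGaloisStructure.setoid : Setoid (HopfGaloisStructure F L) where
  r := HopfGaloisStructure.Equivalent
  iseqv :=
    { refl := fun S => ⟨BialgEquiv.refl F S.H, fun _ _ => rfl⟩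
      symm := by
        rintro S T ⟨e, he⟩
        refine ⟨e.symm, fun h x => ?_⟩
        have := he (e.symm h) x
        rw [BialgEquiv.apply_symm_apply] at this
        exact this.symm
      trans := by
        rintro S T U ⟨e, he⟩ ⟨f, hf⟩
        exact ⟨e.trans f, fun h x => (hf (e h) x).trans (he h x)⟩ }

/-- The action of `g ∈ Gal(L/F)` on the group algebra `L[N]`: by Galois automorphisms on the
coefficients and by conjugation with `λ(g)` on `N`. -/
def groupAlgebraAction (N : Subgroup (Equiv.Perm Gal(L/F))) (hN : IsNormalizedByLeft N)
    (g : Gal(L/F)) : MonoidAlgebra L N →ₐ[F] MonoidAlgebra L N :=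
  (MonoidAlgebra.mapDomainAlgHom F L (conjLeft N hN g).toMonoidHom).comp
    (MonoidAlgebra.mapAlgHom N g.toAlgHom)

/-- The fixed ring `L[N]^G`, where `G = Gal(L/F)`. -/
def fixedRing (N : Subgroup (Equiv.Perm Gal(L/F))) (hN : IsNormalizedByLeft N) :
    Subalgebra F (MonoidAlgebra L N) :=
  ⨅ g : Gal(L/F), AlgHom.equalizer (groupAlgebraAction N hN g) (AlgHom.id F (MonoidAlgebra L N))

/-- The regular subgroup `N` of `Perm(G)`, normalised by `λ(G)`, is the underlying group of the
Hopf-Galois structure `S`: there is an isomorphism from the Hopf algebra of `S` to `L[N]^G` under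
which the comultiplication and counit are the restrictions of those of the `L`-Hopf algebra `L[N]`
and the action on `L` is that of Greither and Pareigis,
`(∑ c_η η) x = ∑ c_η (η⁻¹[1_G])(x)`. -/
def HopfGaloisStructure.HasUnderlyingGroup (S : HopfGaloisStructure F L)
    (N : Subgroup (Equiv.Perm Gal(L/F))) : Prop :=
  IsRegular N ∧ ∃ (hN : IsNormalizedByLeft N) (e : S.H ≃ₐ[F] fixedRing N hN),
    (∀ h : S.H,
      Coalgebra.comul (R := L) (e h : MonoidAlgebra L N) =
        TensorProduct.mapOfCompatibleSMul L F F (MonoidAlgebra L N) (MonoidAlgebra L N)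
          (TensorProduct.map
            ((fixedRing N hN).val.comp e.toAlgHom).toLinearMap
            ((fixedRing N hN).val.comp e.toAlgHom).toLinearMap
            (Coalgebra.comul (R := F) h))) ∧
    (∀ h : S.H,
      Coalgebra.counit (R := L) (e h : MonoidAlgebra L N) =
        algebraMap F L (Coalgebra.counit (R := F) h)) ∧
    (∀ (h : S.H) (x : L),
      S.act h x = (e h : MonoidAlgebra L N).coeff.sum
        fun η c => c * ((η : Equiv.Perm Gal(L/F))⁻¹ 1) x)

/-- `S` is of type `T` if it has an underlying group isomorphic to the group `T`. -/
def HopfGaloisStructure.IsOfType (S : HopfGaloisStructure F L) (T : Type*) [Group T] : Prop :=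
  ∃ N : Subgroup (Equiv.Perm Gal(L/F)), S.HasUnderlyingGroup N ∧ Nonempty (N ≃* T)

end Structures

/-- The group `C₄ × C₂`. -/
abbrev C4C2 : Type := Multiplicative (ZMod 4) × Multiplicative (ZMod 2)

end HopfGalois

end

-- The proof splits into Galois descent and a computation in $\mathrm{Perm}(G)$.
--
-- Descent: $G$ acts semilinearly on $L[N]$, so an $F$-basis of $H=L[N]^G$ is an $L$-basis of
-- $L[N]$, and the Hopf operations of $L[N]$, being $G$-equivariant, restrict to $H$. By Dedekind
-- independence and a dimension count, $L[N]\to\mathrm{End}_F(L)$ is bijective, which makes $H$ a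
-- Hopf–Galois structure (`structureOf`). The group $N$ determines the structure
-- (`HasUnderlyingGroup.equivalent`), and the operators by which $H$ acts determine $N$
-- (`HasUnderlyingGroup.eq`). Since a type is defined through an underlying group, it remains to
-- count the regular $N\cong C_4\times C_2$ normalized by $\lambda(G)$.
--
-- Group theory: conjugation by $\lambda(\sigma),\lambda(\tau)$ gives a homomorphism
-- $Q_8\to\mathrm{Aut}(N)\cong D_4$. It is not injective, so its image is elementary abelian of
-- order at most 4; either one of $\sigma,\tau,\sigma\tau$ acts trivially or the image contains the
-- centre of $D_4$, generated by inversion. Hence some $s$ among the three acts as the identity or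
-- inversion. Inversion would force $s^2=1$, so $\lambda(s)$ centralizes $N$ and lies in it. The
-- element of $N$ taking $1$ to $t$, corrected by $\lambda(s)$ if its square is trivial, is then a
-- right translation, and $N=A_{s,t}$ by cardinality (`exists_eq_groupA`).

universe w w'

noncomputable section

open scoped TensorProduct

namespace HopfGalois

/-! ### Galois descent for vector spaces -/

section Descent

variable {F : Type u} {L : Type v} [Field F] [Field L] [Algebra F L]
  {V : Type*} [AddCommGroup V] [Module F V] [Module L V]

/-- A semilinear action of `Gal(L/F)` on an `L`-vector space. -/
structure IsSemilinearAction (act : Gal(L/F) → V →ₗ[F] V) : Prop where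
  map_smul : ∀ g (l : L) v, act g (l • v) = g l • act g v
  one : ∀ v, act 1 v = v
  mul : ∀ g h v, act (g * h) v = act g (act h v)

variable [FiniteDimensional F L] [IsGalois F L] [IsScalarTower F L V]
  {act : Gal(L/F) → V →ₗ[F] V} {W : Submodule F V}

include L in
/-- Vectors fixed by a semilinear action are linearly independent over `L` if they are so
over `F`. -/
theorem linearIndependent_of_fixed (hact : IsSemilinearAction act) {ι : Type*} {b : ι → V}
    (hb : LinearIndependent F b) (hfix : ∀ i g, act g (b i) = b i) : LinearIndependent L b := by
  classical
  rw [linearIndependent_iff'] at hb ⊢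
  intro s a ha i hi
  -- Averaging `l` times the relation over the Galois group turns its coefficients into traces, a
  -- relation over `F`; nondegeneracy of the trace form then gives `a i = 0`.
  have htr : ∀ l : L, Algebra.trace F L (l * a i) = 0 := by
    intro l
    refine hb s (fun j => Algebra.trace F L (l * a j)) ?_ i hi
    have h1 : ∑ g : Gal(L/F), act g (l • ∑ j ∈ s, a j • b j) = 0 := by simp [ha]
    rw [← h1, Finset.smul_sum]
    simp_rw [map_sum]
    rw [Finset.sum_comm]
    refine Finset.sum_congr rfl fun j _ => ?_
    rw [← algebraMap_smul L (Algebra.trace F L (l * a j)), trace_eq_sum_automorphisms,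
      Finset.sum_smul]
    refine Finset.sum_congr rfl fun g _ => ?_
    rw [smul_smul, hact.map_smul, hfix]
  refine (traceForm_nondegenerate F L).1 _ fun l => ?_
  rw [Algebra.traceForm_apply, mul_comm]
  exact htr l

omit [FiniteDimensional F L] [IsGalois F L] [IsScalarTower F L V] in
theorem sum_act_fixed [Fintype Gal(L/F)] (hact : IsSemilinearAction act) (v : V) (g : Gal(L/F)) :
    act g (∑ h, act h v) = ∑ h, act h v := by
  rw [map_sum]
  simp_rw [← hact.mul]
  exact Fintype.sum_equiv (Equiv.mulLeft g) _ _ fun _ => rfl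

omit [IsGalois F L] [IsScalarTower F L V] in
/-- The vectors fixed by a semilinear action span. -/
theorem span_fixed (hact : IsSemilinearAction act) (hW : ∀ v, (∀ g, act g v = v) → v ∈ W) :
    Submodule.span L (W : Set V) = ⊤ := by
  classical
  rw [eq_top_iff]
  intro v _
  by_contra hv
  obtain ⟨f, hfv, hf⟩ := Submodule.exists_le_ker_of_notMem hv
  -- The functional `f` kills the fixed vector `∑ g, act g (l • v)`. This is a linear relation
  -- between automorphisms, so by Dedekind every coefficient vanishes, including `f v`.
  have key : ∀ l : L, ∑ g : Gal(L/F), f (act g v) * g l = 0 := by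
    intro l
    have h1 : f (∑ g : Gal(L/F), act g (l • v)) = 0 :=
      hf (Submodule.subset_span (hW _ (sum_act_fixed hact _)))
    rw [← h1, map_sum]
    refine Finset.sum_congr rfl fun g _ => ?_
    rw [hact.map_smul, map_smul, smul_eq_mul, mul_comm]
  have hli := (linearIndependent_monoidHom L L).comp
    (fun g : Gal(L/F) => (g : L →* L)) (fun g h hgh => by
      ext x; exact DFunLike.congr_fun hgh x)
  rw [Fintype.linearIndependent_iff] at hli
  have := hli (fun g => f (act g v)) (by
    ext l
    simpa [Finset.sum_apply] using key l) 1
  rw [hact.one] at this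
  exact hfv this

/-- An `F`-basis of the fixed vectors of a semilinear action is an `L`-basis. -/
theorem exists_basis_of_fixed (hact : IsSemilinearAction act)
    (hW : ∀ v, v ∈ W ↔ ∀ g, act g v = v) {ι : Type*} (b : Module.Basis ι F W) :
    ∃ b' : Module.Basis ι L V, ∀ i, b' i = b i := by
  have hli : LinearIndependent L (fun i => (b i : V)) :=
    linearIndependent_of_fixed hact
      (b.linearIndependent.map' W.subtype (by simp)) (fun i => (hW _).1 (b i).2)
  have hsp : ⊤ ≤ Submodule.span L (Set.range fun i => (b i : V)) := by
    rw [← span_fixed hact fun v hv => (hW v).2 hv, Submodule.span_le]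
    intro w hw
    have h1 : (⟨w, hw⟩ : W) ∈ Submodule.span F (Set.range b) := by simp [b.span_eq]
    have h2 := Submodule.mem_map_of_mem (f := W.subtype) h1
    rw [Submodule.map_span, ← Set.range_comp] at h2
    exact Submodule.span_subset_span F L _ h2
  exact ⟨Module.Basis.mk hli hsp, fun i => by simp⟩

end Descent

/-! ### Bases adapted to a form of a vector space, and tensor products -/

section Form

variable (F : Type u) {L : Type v} [Field F] [Field L] [Algebra F L]
  {V : Type w} {V' : Type w'} [AddCommGroup V] [Module F V] [AddCommGroup V'] [Module F V']
  {W W' : Type*} [AddCommGroup W] [Module F W] [Module L W] [IsScalarTower F L W]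
  [AddCommGroup W'] [Module F W'] [Module L W'] [IsScalarTower F L W']

/-- A linear map from an `F`-space to an `L`-space is an `F`-form if it maps some basis to a
basis. -/
def IsForm {V : Type w} [AddCommGroup V] [Module F V] (L : Type v) [Field L] [Algebra F L] {W : Type*} [AddCommGroup W] [Module F W]
    [Module L W] (φ : V →ₗ[F] W) : Prop :=
  ∃ (ι : Type w) (b : Module.Basis ι F V) (b' : Module.Basis ι L W), ∀ i, b' i = φ (b i)

variable (L) in
/-- The map `V ⊗_F V' → W ⊗_L W'` induced by maps `V → W` and `V' → W'`. -/
def formTensor (φ : V →ₗ[F] W) (ψ : V' →ₗ[F] W') : V ⊗[F] V' →ₗ[F] W ⊗[L] W' :=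
  TensorProduct.mapOfCompatibleSMul L F F W W' ∘ₗ TensorProduct.map φ ψ

variable {F}

@[simp]
theorem formTensor_tmul (φ : V →ₗ[F] W) (ψ : V' →ₗ[F] W') (x : V) (y : V') :
    formTensor F L φ ψ (x ⊗ₜ y) = φ x ⊗ₜ ψ y := rfl

theorem IsForm.injective {φ : V →ₗ[F] W} (h : IsForm F L φ) : Function.Injective φ := by
  obtain ⟨ι, b, b', hb⟩ := h
  have h1 : LinearIndependent F (fun i => φ (b i)) := by
    simp_rw [← hb]
    exact b'.linearIndependent.restrict_scalars' F
  rw [← LinearMap.ker_eq_bot]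
  rw [LinearMap.ker_eq_bot']
  intro v hv
  rw [← b.linearCombination_repr v, Finsupp.apply_linearCombination] at hv
  have := (linearIndependent_iff.1 h1) _ hv
  rwa [map_eq_zero_iff _ b.repr.injective] at this

theorem IsForm.tensor {φ : V →ₗ[F] W} {ψ : V' →ₗ[F] W'} (hφ : IsForm F L φ)
    (hψ : IsForm F L ψ) : IsForm F L (formTensor F L φ ψ) := by
  obtain ⟨ι, b, b', hb⟩ := hφ
  obtain ⟨κ, c, c', hc⟩ := hψ
  exact ⟨_, b.tensorProduct c, b'.tensorProduct c', fun i => by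
    rw [Module.Basis.tensorProduct_apply', Module.Basis.tensorProduct_apply', hb, hc,
      formTensor_tmul]⟩

omit [IsScalarTower F L W] [Module F W'] [IsScalarTower F L W'] in
/-- Two `L`-linear maps that agree on a form are equal. -/
theorem IsForm.hom_ext {φ : V →ₗ[F] W} (h : IsForm F L φ) {f g : W →ₗ[L] W'}
    (hfg : ∀ v, f (φ v) = g (φ v)) : f = g := by
  obtain ⟨ι, b, b', hb⟩ := h
  exact b'.ext fun i => by rw [hb, hfg]

/-- The map `L ⊗_F V → W` induced by a form is bijective. -/
theorem IsForm.bijective_comp {φ : V →ₗ[F] W} (h : IsForm F L φ) {f : L ⊗[F] V →ₗ[F] W}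
    (hf : ∀ l v, f (l ⊗ₜ v) = l • φ v) : Function.Bijective f := by
  obtain ⟨ι, b, b', hb⟩ := h
  let e := (b.baseChange L).equiv b' (Equiv.refl ι)
  have : ∀ z, f z = e z := by
    intro z
    induction z with
    | zero => simp
    | add x y hx hy => rw [map_add, map_add, hx, hy]
    | tmul l v =>
      rw [hf]
      have h1 : e (l ⊗ₜ v) = l • e (1 ⊗ₜ v) := by
        rw [← map_smul, TensorProduct.smul_tmul', smul_eq_mul, mul_one]
      rw [h1]
      congr 1
      let p : V →ₗ[F] W := (e.toLinearMap.restrictScalars F) ∘ₗ TensorProduct.mk F L V 1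
      have : φ = p := b.ext fun i => by
        have := (b.baseChange L).equiv_apply i b' (Equiv.refl ι)
        simp only [Module.Basis.baseChange_apply] at this
        rw [← hb]
        exact this.symm
      exact congr($this v)
  rw [show (f : L ⊗[F] V → W) = e from funext this]
  exact e.bijective

end Form

/-! ### Descent of Hopf algebras -/

section HopfDescent

variable {F : Type u} {L : Type v} [Field F] [Field L] [Algebra F L]
  {A : Type*} [Ring A] [HopfAlgebra L A] [Algebra F A] [IsScalarTower F L A]

variable (L) in
/-- The map `B ⊗_F B → A ⊗_L A` for an `F`-subalgebra `B` of an `L`-algebra `A`. -/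
abbrev tensorVal (B : Subalgebra F A) : B ⊗[F] B →ₗ[F] A ⊗[L] A :=
  formTensor F L B.val.toLinearMap B.val.toLinearMap

theorem tensorVal_mul (B : Subalgebra F A) (x y : B ⊗[F] B) :
    tensorVal L B (x * y) = tensorVal L B x * tensorVal L B y := by
  induction x with
  | zero => simp
  | add x x' hx hx' => simp [add_mul, hx, hx']
  | tmul x x' =>
    induction y with
    | zero => simp
    | add y y' hy hy' => simp only [mul_add, map_add, hy, hy']
    | tmul y y' => simp

/-- An `F`-subalgebra `B` of an `L`-Hopf algebra `A` that is a form of `A` and to which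
the comultiplication, counit and antipode restrict. -/
structure IsHopfForm (B : Subalgebra F A) : Prop where
  isForm : IsForm F L B.val.toLinearMap
  comul_mem : ∀ h : B, Coalgebra.comul (R := L) (h : A) ∈ LinearMap.range (tensorVal L B)
  counit_mem : ∀ h : B, Coalgebra.counit (R := L) (h : A) ∈ LinearMap.range (Algebra.linearMap F L)
  antipode_mem : ∀ h : B, HopfAlgebra.antipode L (h : A) ∈ B

namespace IsHopfForm

variable {B : Subalgebra F A} (hB : IsHopfForm (L := L) B)
include hB

/-- The comultiplication of a Hopf form. -/
def comul : B →ₗ[F] B ⊗[F] B :=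
  (LinearEquiv.ofInjective (tensorVal L B) (hB.isForm.tensor hB.isForm).injective).symm.toLinearMap ∘ₗ
    LinearMap.codRestrict (LinearMap.range (tensorVal L B))
      ((Coalgebra.comul (R := L) (A := A)).restrictScalars F ∘ₗ B.val.toLinearMap) hB.comul_mem

/-- The counit of a Hopf form. -/
def counit : B →ₗ[F] F :=
  (LinearEquiv.ofInjective (Algebra.linearMap F L) (algebraMap F L).injective).symm.toLinearMap ∘ₗ
    LinearMap.codRestrict (LinearMap.range (Algebra.linearMap F L))
      ((Coalgebra.counit (R := L) (A := A)).restrictScalars F ∘ₗ B.val.toLinearMap) hB.counit_mem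

/-- The antipode of a Hopf form. -/
def antipode : B →ₗ[F] B :=
  LinearMap.codRestrict (Subalgebra.toSubmodule B)
    ((HopfAlgebra.antipode L (A := A)).restrictScalars F ∘ₗ B.val.toLinearMap) hB.antipode_mem

theorem tensorVal_comul (h : B) :
    tensorVal L B (hB.comul h) = Coalgebra.comul (R := L) (h : A) := by
  have := LinearEquiv.ofInjective_symm_apply
    (h := (hB.isForm.tensor hB.isForm).injective) (f := tensorVal L B) ⟨_, hB.comul_mem h⟩
  exact this

theorem algebraMap_counit (h : B) :
    algebraMap F L (hB.counit h) = Coalgebra.counit (R := L) (h : A) :=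
  LinearEquiv.ofInjective_symm_apply
    (h := (algebraMap F L).injective) (f := Algebra.linearMap F L) ⟨_, hB.counit_mem h⟩

theorem coe_antipode (h : B) :
    (hB.antipode h : A) = HopfAlgebra.antipode L (h : A) := rfl

theorem tensorVal_injective : Function.Injective (tensorVal L B) :=
  (hB.isForm.tensor hB.isForm).injective

-- This and the next lemmas carry both sides of each Hopf axiom from tensor powers of `B` over `F`
-- to those of `A` over `L`, where the axiom is known.
set_option synthInstance.maxHeartbeats 200000 in
theorem coassoc_aux (z : B ⊗[F] B) :
    formTensor F L B.val.toLinearMap (tensorVal L B)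
      (TensorProduct.assoc F B B B (hB.comul.rTensor B z)) =
    TensorProduct.assoc L A A A
      ((Coalgebra.comul (R := L) (A := A)).rTensor A (tensorVal L B z)) := by
  induction z with
  | zero => simp
  | add x y hx hy => simp only [map_add, hx, hy]
  | tmul x y =>
    have : ∀ w : B ⊗[F] B, formTensor F L B.val.toLinearMap (tensorVal L B)
        (TensorProduct.assoc F B B B (w ⊗ₜ y)) =
        TensorProduct.assoc L A A A (tensorVal L B w ⊗ₜ (y : A)) := by
      intro w
      induction w with
      | zero => simp
      | add x y hx hy => simp only [map_add, TensorProduct.add_tmul, hx, hy]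
      | tmul a b => simp
    rw [LinearMap.rTensor_tmul, this, hB.tensorVal_comul]
    simp

theorem coassoc_aux' (z : B ⊗[F] B) :
    formTensor F L B.val.toLinearMap (tensorVal L B) (hB.comul.lTensor B z) =
      (Coalgebra.comul (R := L) (A := A)).lTensor A (tensorVal L B z) := by
  induction z with
  | zero => simp
  | add x y hx hy => simp only [map_add, hx, hy]
  | tmul x y => simp [hB.tensorVal_comul]

theorem rTensor_counit_aux (z : B ⊗[F] B) :
    (TensorProduct.lid F B (hB.counit.rTensor B z) : A) =
      TensorProduct.lid L A ((Coalgebra.counit (R := L) (A := A)).rTensor A (tensorVal L B z)) := by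
  induction z with
  | zero => simp
  | add x y hx hy => simp only [map_add, hx, hy, Subalgebra.coe_add]
  | tmul x y => simp [← hB.algebraMap_counit]

theorem lTensor_counit_aux (z : B ⊗[F] B) :
    (TensorProduct.rid F B (hB.counit.lTensor B z) : A) =
      TensorProduct.rid L A ((Coalgebra.counit (R := L) (A := A)).lTensor A (tensorVal L B z)) := by
  induction z with
  | zero => simp
  | add x y hx hy => simp only [map_add, hx, hy, Subalgebra.coe_add]
  | tmul x y => simp [← hB.algebraMap_counit]

theorem rTensor_antipode_aux (z : B ⊗[F] B) :
    (LinearMap.mul' F B (hB.antipode.rTensor B z) : A) =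
      LinearMap.mul' L A ((HopfAlgebra.antipode L (A := A)).rTensor A (tensorVal L B z)) := by
  induction z with
  | zero => simp
  | add x y hx hy => simp only [map_add, hx, hy, Subalgebra.coe_add]
  | tmul x y => simp [hB.coe_antipode]

theorem lTensor_antipode_aux (z : B ⊗[F] B) :
    (LinearMap.mul' F B (hB.antipode.lTensor B z) : A) =
      LinearMap.mul' L A ((HopfAlgebra.antipode L (A := A)).lTensor A (tensorVal L B z)) := by
  induction z with
  | zero => simp
  | add x y hx hy => simp only [map_add, hx, hy, Subalgebra.coe_add]
  | tmul x y => simp [hB.coe_antipode]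

/-- A Hopf form is a coalgebra. -/
abbrev coalgebra : Coalgebra F B where
  comul := hB.comul
  counit := hB.counit
  coassoc := by
    ext h : 1
    apply (hB.isForm.tensor (hB.isForm.tensor hB.isForm)).injective
    simp only [LinearMap.comp_apply, LinearEquiv.coe_coe]
    rw [hB.coassoc_aux, hB.coassoc_aux', hB.tensorVal_comul]
    exact Coalgebra.coassoc_apply _
  rTensor_counit_comp_comul := by
    ext h : 1
    apply (TensorProduct.lid F B).injective
    apply Subtype.val_injective
    rw [LinearMap.comp_apply, hB.rTensor_counit_aux, hB.tensorVal_comul]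
    simp
  lTensor_counit_comp_comul := by
    ext h : 1
    apply (TensorProduct.rid F B).injective
    apply Subtype.val_injective
    rw [LinearMap.comp_apply, hB.lTensor_counit_aux, hB.tensorVal_comul]
    simp

theorem counit_one : hB.counit 1 = 1 := by
  apply (algebraMap F L).injective
  rw [hB.algebraMap_counit]
  simp

theorem counit_mul (a b : B) : hB.counit (a * b) = hB.counit a * hB.counit b := by
  apply (algebraMap F L).injective
  rw [RingHom.map_mul, hB.algebraMap_counit, hB.algebraMap_counit, hB.algebraMap_counit]
  simp

theorem comul_one : hB.comul 1 = 1 := by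
  apply hB.tensorVal_injective
  rw [hB.tensorVal_comul, Algebra.TensorProduct.one_def]
  simp [Algebra.TensorProduct.one_def]

theorem comul_mul (a b : B) : hB.comul (a * b) = hB.comul a * hB.comul b := by
  apply hB.tensorVal_injective
  rw [tensorVal_mul, hB.tensorVal_comul, hB.tensorVal_comul, hB.tensorVal_comul]
  simp

/-- A Hopf form is a bialgebra. -/
abbrev bialgebra : Bialgebra F B :=
  letI := hB.coalgebra
  Bialgebra.mk' F B hB.counit_one (hB.counit_mul _ _) hB.comul_one (hB.comul_mul _ _)

/-- A Hopf form is a Hopf algebra. -/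
abbrev hopfAlgebra : HopfAlgebra F B where
  __ := hB.bialgebra
  antipode := hB.antipode
  mul_antipode_rTensor_comul := by
    ext h : 2
    change (LinearMap.mul' F B (hB.antipode.rTensor B (hB.comul h)) : A) =
      algebraMap F A (hB.counit h)
    rw [hB.rTensor_antipode_aux, hB.tensorVal_comul,
      HopfAlgebra.mul_antipode_rTensor_comul_apply, ← hB.algebraMap_counit,
      ← IsScalarTower.algebraMap_apply]
  mul_antipode_lTensor_comul := by
    ext h : 2
    change (LinearMap.mul' F B (hB.antipode.lTensor B (hB.comul h)) : A) =
      algebraMap F A (hB.counit h)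
    rw [hB.lTensor_antipode_aux, hB.tensorVal_comul,
      HopfAlgebra.mul_antipode_lTensor_comul_apply, ← hB.algebraMap_counit,
      ← IsScalarTower.algebraMap_apply]

end IsHopfForm

end HopfDescent

/-! ### The fixed ring as a Hopf-Galois structure -/

section FormRange

variable {F : Type u} {L : Type v} [Field F] [Field L] [Algebra F L]
  {V : Type*} [AddCommGroup V] [Module F V]
  {W : Type*} [AddCommGroup W] [Module F W] [Module L W] [IsScalarTower F L W]

/-- A vector whose coordinates lie in `F` is in the image of the form. -/
theorem mem_range_of_repr {φ : V →ₗ[F] W} {ι : Type*} {b : Module.Basis ι F V}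
    {b' : Module.Basis ι L W} (hb : ∀ i, b' i = φ (b i)) {w : W}
    (hw : ∀ i, b'.repr w i ∈ Set.range (algebraMap F L)) : w ∈ LinearMap.range φ := by
  rw [← b'.linearCombination_repr w, Finsupp.linearCombination_apply]
  refine Submodule.sum_mem _ fun i _ => ?_
  obtain ⟨r, hr⟩ := hw i
  refine ⟨r • b i, ?_⟩
  simp only [map_smul, ← hb, ← hr, algebraMap_smul]

omit [IsScalarTower F L W] in
/-- Coordinates with respect to a basis of fixed vectors are equivariant. -/
theorem repr_act {act : Gal(L/F) → W →ₗ[F] W} (hact : IsSemilinearAction act) {ι : Type*}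
    (b : Module.Basis ι L W) (hb : ∀ i g, act g (b i) = b i) (g : Gal(L/F)) (w : W) (i : ι) :
    b.repr (act g w) i = g (b.repr w i) := by
  classical
  conv_lhs => rw [← b.linearCombination_repr w, Finsupp.linearCombination_apply]
  simp only [Finsupp.sum, map_sum, hact.map_smul, hb, map_smul, Module.Basis.repr_self,
    Finsupp.finsetSum_apply, Finsupp.smul_apply, smul_eq_mul, Finsupp.single_apply, mul_ite,
    mul_one, mul_zero, Finset.sum_ite_eq', Finsupp.mem_support_iff]
  split_ifs with h
  · rfl
  · rw [not_not.1 h, map_zero]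

end FormRange

section FixedRing

variable {F : Type u} {L : Type v} [Field F] [Field L] [Algebra F L]
  {N : Subgroup (Equiv.Perm Gal(L/F))} (hN : IsNormalizedByLeft N)

theorem coe_conjLeft (g : Gal(L/F)) (η : N) :
    (conjLeft N hN g η : Equiv.Perm Gal(L/F)) =
      leftRegular Gal(L/F) g * η * (leftRegular Gal(L/F) g)⁻¹ := rfl

@[simp]
theorem groupAlgebraAction_single (g : Gal(L/F)) (η : N) (c : L) :
    groupAlgebraAction N hN g (MonoidAlgebra.single η c) =
      MonoidAlgebra.single (conjLeft N hN g η) (g c) := by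
  simp [groupAlgebraAction]

theorem isSemilinearAction_groupAlgebraAction :
    IsSemilinearAction (fun g : Gal(L/F) => (groupAlgebraAction N hN g).toLinearMap) where
  map_smul g l v := by
    induction v using MonoidAlgebra.induction_linear with
    | zero => simp
    | add x y hx hy => rw [smul_add, map_add, map_add, hx, hy, smul_add]
    | single η c => simp
  one v := by
    induction v using MonoidAlgebra.induction_linear with
    | zero => simp
    | add x y hx hy => rw [map_add, hx, hy]
    | single η c =>
      have : conjLeft N hN 1 η = η := by
        apply Subtype.ext; rw [coe_conjLeft]; simp
      simp [this]
  mul g h v := by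
    induction v using MonoidAlgebra.induction_linear with
    | zero => simp
    | add x y hx hy => simp only [map_add, hx, hy]
    | single η c =>
      have : conjLeft N hN (g * h) η = conjLeft N hN g (conjLeft N hN h η) := by
        apply Subtype.ext; simp only [coe_conjLeft, map_mul]; group
      simp [this]

theorem mem_fixedRing {f : MonoidAlgebra L N} :
    f ∈ fixedRing N hN ↔ ∀ g : Gal(L/F), groupAlgebraAction N hN g f = f := by
  simp [fixedRing, Algebra.mem_iInf, AlgHom.mem_equalizer]

/-- The `L`-linear map `L[N] → End_F(L)` given by `(∑ c_η η)(x) = ∑ c_η (η⁻¹[1])(x)`. -/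
def actionMap (N : Subgroup (Equiv.Perm Gal(L/F))) : MonoidAlgebra L N →ₗ[L] Module.End F L :=
  Finsupp.linearCombination L
    (fun η : N => (((η : Equiv.Perm Gal(L/F))⁻¹ 1 : Gal(L/F)) : L →ₗ[F] L)) ∘ₗ
    (MonoidAlgebra.coeffLinearEquiv L).toLinearMap

theorem actionMap_apply (f : MonoidAlgebra L N) (x : L) :
    actionMap N f x = f.coeff.sum fun η c => c * ((η : Equiv.Perm Gal(L/F))⁻¹ 1) x := by
  simp [actionMap, Finsupp.linearCombination_apply, Finsupp.sum]

@[simp]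
theorem actionMap_single (η : N) (c x : L) :
    actionMap N (MonoidAlgebra.single η c) x = c * ((η : Equiv.Perm Gal(L/F))⁻¹ 1) x := by
  rw [actionMap_apply]
  simp

/-- With $k=\eta^{-1}[1]$, the inverse of $\eta\lambda(k)\mu\lambda(k)^{-1}$ sends $1$ to
$k\,\mu^{-1}[1]$, and $k$ acts multiplicatively on $L$. The Galois twist compensates for moving `k`
past the coefficients of `f`. -/
theorem actionMap_single_mul (η : N) (c : L) (f : MonoidAlgebra L N) (x : L) :
    actionMap N (MonoidAlgebra.single η c *
      groupAlgebraAction N hN ((η : Equiv.Perm Gal(L/F))⁻¹ 1) f) x =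
    actionMap N (MonoidAlgebra.single η c) (actionMap N f x) := by
  induction f using MonoidAlgebra.induction_linear with
  | zero => simp
  | add x y hx hy => simp only [map_add, mul_add, LinearMap.add_apply, hx, hy]
  | single μ d =>
    simp [coe_conjLeft, leftRegular, mul_assoc]

/-- `actionMap` need not be multiplicative on all of $L[N]$; for a fixed right factor the twist
above disappears. -/
theorem actionMap_mul (h : MonoidAlgebra L N) {f : MonoidAlgebra L N} (hf : f ∈ fixedRing N hN) :
    actionMap N (h * f) = actionMap N h * actionMap N f := by
  ext x
  induction h using MonoidAlgebra.induction_linear with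
  | zero => simp
  | add x y hx hy => simp only [map_add, add_mul, LinearMap.add_apply, hx, hy]
  | single η c =>
    rw [Module.End.mul_apply, ← actionMap_single_mul hN, (mem_fixedRing hN).1 hf]

theorem IsRegular.injective_inv_apply_one {G : Type*} [Group G] {N : Subgroup (Equiv.Perm G)}
    (hreg : IsRegular N) : Function.Injective fun η : N => (η : Equiv.Perm G)⁻¹ 1 := by
  intro η μ h
  have := hreg.eq_one_of_fixes (η * (μ : Equiv.Perm G)⁻¹) (N.mul_mem η.2 (N.inv_mem μ.2)) 1
    (by
      rw [Equiv.Perm.mul_apply, ← show (η : Equiv.Perm G)⁻¹ 1 = (μ : Equiv.Perm G)⁻¹ 1 from h,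
        ← Equiv.Perm.mul_apply, mul_inv_cancel, Equiv.Perm.one_apply])
  exact Subtype.ext (mul_inv_eq_one.1 this)

theorem actionMap_injective (hreg : IsRegular N) : Function.Injective (actionMap N) := by
  have h1 : LinearIndependent L
      (fun η : N => (((η : Equiv.Perm Gal(L/F))⁻¹ 1 : Gal(L/F)) : L →ₗ[F] L)) :=
    (linearIndependent_algHom_toLinearMap F L L).comp
      (fun η : N => (((η : Equiv.Perm Gal(L/F))⁻¹ 1 : Gal(L/F)) : L →ₐ[F] L))
      (fun η μ h => hreg.injective_inv_apply_one (by
        ext x; exact DFunLike.congr_fun h x))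
  exact Function.Injective.comp (g := Finsupp.linearCombination L _) h1 (LinearEquiv.injective _)

variable [FiniteDimensional F L] [IsGalois F L]

theorem actionMap_bijective (hreg : IsRegular N) : Function.Bijective (actionMap N) := by
  have : Finite N := inferInstance
  have := Fintype.ofFinite N
  -- Both sides have dimension $[L:F]^2$, because $|N|=|G|=[L:F]$.
  have h1 : Module.finrank F (MonoidAlgebra L N) = Module.finrank F (Module.End F L) := by
    rw [← Module.finrank_mul_finrank F L (MonoidAlgebra L N),
      (MonoidAlgebra.coeffLinearEquiv L).finrank_eq, Module.finrank_finsupp_self,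
      Module.finrank_linearMap, Fintype.card_eq_nat_card, hreg.card_eq,
      IsGalois.card_aut_eq_finrank]
  refine ⟨actionMap_injective hreg, ?_⟩
  have : Module.Finite F (MonoidAlgebra L N) := Module.Finite.trans L _
  exact (LinearMap.injective_iff_surjective_of_finrank_eq_finrank
    (f := (actionMap N).restrictScalars F) h1).1 (actionMap_injective hreg)

/-- The fixed ring is a Hopf form of `L[N]`. -/
theorem isHopfForm_fixedRing : IsHopfForm (L := L) (fixedRing N hN) := by
  have hact := isSemilinearAction_groupAlgebraAction hN
  have hfin := Fintype.ofFinite N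
  have : Module.Finite F (MonoidAlgebra L N) := Module.Finite.trans L _
  let b := Module.Basis.ofVectorSpace F (fixedRing N hN)
  obtain ⟨b', hb'⟩ := exists_basis_of_fixed (W := Subalgebra.toSubmodule (fixedRing N hN)) hact
    (fun v => mem_fixedRing hN) b
  have hfix : ∀ i g, groupAlgebraAction N hN g (b' i) = b' i := fun i g => by
    rw [hb']; exact (mem_fixedRing hN).1 (b i).2 g
  refine ⟨⟨_, b, b', hb'⟩, fun h => ?_, fun h => ?_, fun h => ?_⟩
  -- In a basis of fixed vectors, coordinates are Galois-equivariant. Those of the comultiplication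
  -- of a fixed element are thus invariant and lie in `F`.
  · refine mem_range_of_repr (b := b.tensorProduct b) (b' := b'.tensorProduct b') ?_ fun ⟨j, k⟩ => ?_
    · intro i
      rw [Module.Basis.tensorProduct_apply', Module.Basis.tensorProduct_apply', formTensor_tmul,
        hb', hb']
      rfl
    · rw [IsGalois.mem_range_algebraMap_iff_fixed]
      intro g
      have key : ∀ f : MonoidAlgebra L N, g ((b'.tensorProduct b').repr
          (Coalgebra.comul (R := L) f) (j, k)) =
          (b'.tensorProduct b').repr (Coalgebra.comul (R := L) (groupAlgebraAction N hN g f)) (j, k) := by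
        intro f
        induction f using MonoidAlgebra.induction_linear with
        | zero => simp
        | add x y hx hy => simp only [map_add, Finsupp.add_apply, hx, hy]
        | single η c =>
          have e : ∀ (η : N) (c : L), Coalgebra.comul (R := L) (MonoidAlgebra.single η c) =
              c • (MonoidAlgebra.single η (1 : L) ⊗ₜ[L] MonoidAlgebra.single η (1 : L)) := by
            intro η c
            rw [MonoidAlgebra.comul_single, CommSemiring.comul_apply, TensorProduct.map_tmul,
              ← TensorProduct.tmul_smul, MonoidAlgebra.smul_single, smul_eq_mul, mul_one]
            rfl
          have r := fun j => repr_act hact b' hfix g (MonoidAlgebra.single η (1 : L)) j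
          simp only [AlgHom.toLinearMap_apply, groupAlgebraAction_single, map_one] at r
          rw [groupAlgebraAction_single, e, e]
          simp [r, Module.Basis.tensorProduct_repr_tmul_apply]
      rw [key, (mem_fixedRing hN).1 h.2]
  · change _ ∈ Set.range (algebraMap F L)
    rw [IsGalois.mem_range_algebraMap_iff_fixed]
    intro g
    have key : ∀ f : MonoidAlgebra L N, g (Coalgebra.counit (R := L) f) =
        Coalgebra.counit (R := L) (groupAlgebraAction N hN g f) := by
      intro f
      induction f using MonoidAlgebra.induction_linear with
      | zero => simp
      | add x y hx hy => simp only [map_add, hx, hy]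
      | single η c => simp
    rw [key, (mem_fixedRing hN).1 h.2]
  · rw [mem_fixedRing]
    intro g
    have key : ∀ f : MonoidAlgebra L N,
        groupAlgebraAction N hN g (HopfAlgebra.antipode L f) =
          HopfAlgebra.antipode L (groupAlgebraAction N hN g f) := by
      intro f
      induction f using MonoidAlgebra.induction_linear with
      | zero => simp
      | add x y hx hy => simp only [map_add, hx, hy]
      | single η c => simp
    rw [key, (mem_fixedRing hN).1 h.2]

end FixedRing

/-! ### Hopf–Galois structures and their underlying groups -/

section Structures

variable {F : Type u} {L : Type v} [Field F] [Field L] [Algebra F L]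
  {N M : Subgroup (Equiv.Perm Gal(L/F))}

theorem actionMap_one : actionMap N (1 : MonoidAlgebra L N) = 1 := by
  ext x
  rw [MonoidAlgebra.one_def, actionMap_single]
  simp

theorem actionMap_apply_one (f : MonoidAlgebra L N) :
    actionMap N f 1 = Coalgebra.counit (R := L) f := by
  induction f using MonoidAlgebra.induction_linear with
  | zero => simp
  | add x y hx hy => simp only [map_add, LinearMap.add_apply, hx, hy]
  | single η c => simp

/-- The `L`-linear map `L[N] ⊗ L[N] → L` given by `f ⊗ f' ↦ f(x) f'(y)`. -/
def actionMapTensor (N : Subgroup (Equiv.Perm Gal(L/F))) (x y : L) :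
    MonoidAlgebra L N ⊗[L] MonoidAlgebra L N →ₗ[L] L :=
  LinearMap.mul' L L ∘ₗ TensorProduct.map (LinearMap.applyₗ' L x ∘ₗ actionMap N)
    (LinearMap.applyₗ' L y ∘ₗ actionMap N)

/-- Elements of `N` are group-like and act through field automorphisms, which are multiplicative. -/
theorem actionMapTensor_comul (f : MonoidAlgebra L N) (x y : L) :
    actionMapTensor N x y (Coalgebra.comul (R := L) f) = actionMap N f (x * y) := by
  induction f using MonoidAlgebra.induction_linear with
  | zero => simp
  | add f g hf hg => simp only [map_add, LinearMap.add_apply, hf, hg]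
  | single η c =>
    rw [MonoidAlgebra.comul_single, CommSemiring.comul_apply, TensorProduct.map_tmul]
    change actionMap N (MonoidAlgebra.single η 1) x * actionMap N (MonoidAlgebra.single η c) y = _
    simp only [actionMap_single, map_mul]
    ring

/-- The action of the fixed ring on `L`. -/
def actionHom (hN : IsNormalizedByLeft N) : fixedRing N hN →ₐ[F] Module.End F L :=
  AlgHom.ofLinearMap ((actionMap N).restrictScalars F ∘ₗ (fixedRing N hN).val.toLinearMap)
    (by simpa using actionMap_one) (fun h h' => by simpa using actionMap_mul hN h h'.2)

theorem mul'_map_actionHom (hN : IsNormalizedByLeft N) (x y : L)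
    (z : fixedRing N hN ⊗[F] fixedRing N hN) :
    LinearMap.mul' F L (TensorProduct.map ((actionHom hN).toLinearMap.flip x)
      ((actionHom hN).toLinearMap.flip y) z) =
    actionMapTensor N x y (tensorVal L (fixedRing N hN) z) := by
  induction z with
  | zero => simp
  | add a b ha hb => simp only [map_add, ha, hb]
  | tmul a b => rfl

variable [FiniteDimensional F L] [IsGalois F L]

/-- The map $j$ factors as $L\otimes_F L[N]^G\to L[N]\to\mathrm{End}_F(L)$, with both factors
bijective. -/
theorem bijective_lift_actionHom (hreg : IsRegular N) (hN : IsNormalizedByLeft N) :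
    Function.Bijective (TensorProduct.lift ((LinearMap.mul F (Module.End F L)).compl₁₂
      (Algebra.lmul F L).toLinearMap (actionHom hN).toLinearMap)) := by
  let f : L ⊗[F] fixedRing N hN →ₗ[F] MonoidAlgebra L N :=
    TensorProduct.lift ((LinearMap.mul F (MonoidAlgebra L N)).compl₁₂
      ((Algebra.linearMap L (MonoidAlgebra L N)).restrictScalars F)
      (fixedRing N hN).val.toLinearMap)
  have hf : Function.Bijective f :=
    (isHopfForm_fixedRing hN).isForm.bijective_comp fun l v => by simp [f, Algebra.smul_def]
  have h : TensorProduct.lift ((LinearMap.mul F (Module.End F L)).compl₁₂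
      (Algebra.lmul F L).toLinearMap (actionHom hN).toLinearMap) =
      (actionMap N).restrictScalars F ∘ₗ f := by
    apply TensorProduct.ext'
    intro l v
    simp only [f, TensorProduct.lift.tmul, LinearMap.comp_apply, LinearMap.compl₁₂_apply,
      LinearMap.restrictScalars_apply, LinearMap.mul_apply', Algebra.linearMap_apply,
      ← Algebra.smul_def, map_smul]
    rfl
  rw [h]
  exact (actionMap_bijective hreg).comp hf

/-- The Hopf-Galois structure `L[N]^G` of a regular subgroup `N` normalised by `λ(G)`. -/
def structureOf (N : Subgroup (Equiv.Perm Gal(L/F))) (hreg : IsRegular N)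
    (hN : IsNormalizedByLeft N) : HopfGaloisStructure F L :=
  letI := (isHopfForm_fixedRing hN).hopfAlgebra
  { H := fixedRing N hN
    finite := by
      have := Fintype.ofFinite N
      have : Module.Finite F (MonoidAlgebra L N) := Module.Finite.trans L _
      exact inferInstanceAs (Module.Finite F (Subalgebra.toSubmodule (fixedRing N hN)))
    act := actionHom hN
    act_one := fun h =>
      (actionMap_apply_one _).trans ((isHopfForm_fixedRing hN).algebraMap_counit h).symm
    act_mul := fun h x y => by
      refine (actionMapTensor_comul _ x y).symm.trans ?_
      refine (congrArg _ ((isHopfForm_fixedRing hN).tensorVal_comul h).symm).trans ?_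
      exact (mul'_map_actionHom hN x y _).symm
    bijective := bijective_lift_actionHom hreg hN }

theorem hasUnderlyingGroup_structureOf (hreg : IsRegular N) (hN : IsNormalizedByLeft N) :
    (structureOf N hreg hN).HasUnderlyingGroup N :=
  ⟨hreg, hN, AlgEquiv.refl,
    fun h => ((isHopfForm_fixedRing hN).tensorVal_comul h).symm,
    fun h => ((isHopfForm_fixedRing hN).algebraMap_counit h).symm,
    fun _ x => actionMap_apply _ x⟩

omit [FiniteDimensional F L] [IsGalois F L] in
theorem HopfGaloisStructure.HasUnderlyingGroup.congr {S T : HopfGaloisStructure F L}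
    (h : S.HasUnderlyingGroup N) (hST : S.Equivalent T) : T.HasUnderlyingGroup N := by
  obtain ⟨hreg, hN, e, h1, h2, h3⟩ := h
  obtain ⟨f, hf⟩ := hST
  let f' : S.H ≃ₐ[F] T.H := f
  have hsurj : ∀ t, ∃ s, f s = t := f'.surjective
  have hfs : ∀ s, f'.symm (f s) = s := f'.symm_apply_apply
  have hes : ∀ s, (f'.symm.trans e) (f s) = e s := fun s => congrArg e (hfs s)
  refine ⟨hreg, hN, f'.symm.trans e, fun t => ?_, fun t => ?_, fun t x => ?_⟩
  · obtain ⟨s, rfl⟩ := hsurj t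
    have hφ : ((fixedRing N hN).val.comp (f'.symm.trans e).toAlgHom).toLinearMap ∘ₗ
        (f : S.H →ₗ[F] T.H) = ((fixedRing N hN).val.comp e.toAlgHom).toLinearMap :=
      LinearMap.ext fun s => congrArg Subtype.val (hes s)
    rw [hes, h1, ← hφ, TensorProduct.map_comp, LinearMap.comp_apply]
    exact congrArg _ (congrArg _ (CoalgHomClass.map_comp_comul_apply f s))
  · obtain ⟨s, rfl⟩ := hsurj t
    rw [hes, h2, ← CoalgHomClass.counit_comp_apply f s]
  · obtain ⟨s, rfl⟩ := hsurj t
    rw [hf, hes, h3]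

theorem isForm_val_comp_equiv (hN : IsNormalizedByLeft N) {H : Type v} [Ring H] [Algebra F H]
    (e : H ≃ₐ[F] fixedRing N hN) :
    IsForm F L ((fixedRing N hN).val.comp e.toAlgHom).toLinearMap := by
  obtain ⟨ι, b, b', hb⟩ := (isHopfForm_fixedRing hN).isForm
  exact ⟨ι, b.map e.symm.toLinearEquiv, b', fun i => by simp [hb]⟩

/-- A Hopf-Galois structure is determined up to isomorphism by its underlying group. -/
theorem HopfGaloisStructure.HasUnderlyingGroup.equivalent {S T : HopfGaloisStructure F L}
    (hS : S.HasUnderlyingGroup N) (hT : T.HasUnderlyingGroup N) : S.Equivalent T := by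
  obtain ⟨-, hN, e, h1, h2, h3⟩ := hS
  obtain ⟨-, _, e', h1', h2', h3'⟩ := hT
  let f : S.H ≃ₐ[F] T.H := e.trans e'.symm
  have hf : ∀ s, e' (f s) = e s := fun s => e'.apply_symm_apply (e s)
  refine ⟨BialgEquiv.ofAlgEquiv f ?_ ?_, fun s x => ?_⟩
  · ext s
    apply (algebraMap F L).injective
    change algebraMap F L (Coalgebra.counit (R := F) (f s)) =
      algebraMap F L (Coalgebra.counit (R := F) s)
    rw [← h2, ← h2', hf]
  · ext s
    apply ((isForm_val_comp_equiv hN e').tensor (isForm_val_comp_equiv hN e')).injective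
    have hφ : ((fixedRing N hN).val.comp e'.toAlgHom).toLinearMap ∘ₗ f.toLinearMap =
        ((fixedRing N hN).val.comp e.toAlgHom).toLinearMap :=
      LinearMap.ext fun s => congrArg Subtype.val (hf s)
    refine Eq.trans ?_ (h1' (f s))
    rw [hf, h1, ← hφ, TensorProduct.map_comp, LinearMap.comp_apply]
    rfl
  · change T.act (f s) x = _
    rw [h3', hf, h3]

omit [FiniteDimensional F L] [IsGalois F L] in
theorem coeff_conjLeft (hN : IsNormalizedByLeft N) {f : MonoidAlgebra L N}
    (hf : f ∈ fixedRing N hN) (g : Gal(L/F)) (η : N) :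
    f.coeff (conjLeft N hN g η) = g (f.coeff η) := by
  conv_lhs => rw [← (mem_fixedRing hN).1 hf g]
  clear hf
  induction f using MonoidAlgebra.induction_linear with
  | zero => simp
  | add x y hx hy => simp only [map_add, MonoidAlgebra.coeff_add, Finsupp.add_apply, hx, hy]
  | single μ c =>
    classical
    simp only [groupAlgebraAction_single, MonoidAlgebra.coeff_single, Finsupp.single_apply,
      EmbeddingLike.apply_eq_iff_eq]
    split_ifs <;> simp

/-- The fixed ring spans $L[N]$ over $L$, so coefficient functionals that agree on it agree
everywhere. -/
theorem eq_of_coeff_eq (hN : IsNormalizedByLeft N) {η μ : N}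
    (h : ∀ f ∈ fixedRing N hN, f.coeff η = f.coeff μ) : η = μ := by
  classical
  let p : N → MonoidAlgebra L N →ₗ[L] L := fun η =>
    Finsupp.lapply η ∘ₗ (MonoidAlgebra.coeffLinearEquiv L).toLinearMap
  have hp : p η = p μ := (isHopfForm_fixedRing hN).isForm.hom_ext fun v => h _ v.2
  have := congrArg (fun q : MonoidAlgebra L N →ₗ[L] L => q (MonoidAlgebra.single μ 1)) hp
  by_contra hne
  have h1 : (MonoidAlgebra.single μ (1 : L)).coeff η = (MonoidAlgebra.single μ (1 : L)).coeff μ :=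
    this
  simp [Ne.symm hne] at h1

omit [FiniteDimensional F L] [IsGalois F L] in
-- By Dedekind, an operator determines the coefficient of each automorphism in it.
theorem coeff_eq_of_actionMap_eq (hN : IsRegular N) (hM : IsRegular M) {f : MonoidAlgebra L N}
    {f' : MonoidAlgebra L M} (h : actionMap N f = actionMap M f') {η : N} {μ : M}
    (hημ : (η : Equiv.Perm Gal(L/F))⁻¹ 1 = (μ : Equiv.Perm Gal(L/F))⁻¹ 1) :
    f.coeff η = f'.coeff μ := by
  let i : ∀ N : Subgroup (Equiv.Perm Gal(L/F)), N → Gal(L/F) := fun N η =>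
    (η : Equiv.Perm Gal(L/F))⁻¹ 1
  have hli : LinearIndependent L (fun g : Gal(L/F) => (g : L →ₗ[F] L)) :=
    (linearIndependent_algHom_toLinearMap F L L).comp (fun g : Gal(L/F) => (g : L →ₐ[F] L))
      (fun g g' h => by ext x; exact DFunLike.congr_fun h x)
  have key : f.coeff.mapDomain (i N) = f'.coeff.mapDomain (i M) := by
    apply hli
    rw [Finsupp.linearCombination_mapDomain, Finsupp.linearCombination_mapDomain]
    exact h
  have := DFunLike.congr_fun key (i N η)
  rw [Finsupp.mapDomain_apply hN.injective_inv_apply_one] at this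
  rw [this, show i N η = i M μ from hημ, Finsupp.mapDomain_apply hM.injective_inv_apply_one]

/-- Operators only see $\eta^{-1}[1]$, but equivariance of the coefficients of fixed elements
extends this matching to all conjugates by $\lambda(k^{-1})$. The conjugate of $\eta$ yields
$k^{-1}\eta^{-1}[k]$, so all values of $\eta^{-1}$ are recovered. -/
theorem le_of_actionMap_le (hregN : IsRegular N) (hN : IsNormalizedByLeft N)
    (hregM : IsRegular M) (hM : IsNormalizedByLeft M)
    (h : ∀ f ∈ fixedRing N hN, ∃ f' ∈ fixedRing M hM, actionMap N f = actionMap M f') : N ≤ M := by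
  intro η hη
  obtain ⟨μ, hμ, hμ1⟩ := hregM.transitive (η⁻¹ 1) 1
  have hημ : η⁻¹ 1 = μ⁻¹ 1 := by rw [Equiv.Perm.eq_inv_iff_eq, hμ1]
  suffices h : η⁻¹ = μ⁻¹ by rw [inv_inj.1 h]; exact hμ
  ext k : 1
  let μ' := conjLeft M hM k⁻¹ ⟨μ, hμ⟩
  obtain ⟨ν, hν, hν1⟩ := hregN.transitive ((μ' : Equiv.Perm Gal(L/F))⁻¹ 1) 1
  have hν2 : ν⁻¹ 1 = (μ' : Equiv.Perm Gal(L/F))⁻¹ 1 := by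
    rw [Equiv.Perm.inv_eq_iff_eq, hν1]
  -- For fixed `f` with partner `f'`, the coefficient of `f` at `ν` is that of `f'` at `μ'`, which
  -- is `k⁻¹` of that at `μ`, hence `k⁻¹` of that of `f` at `η`.
  have : (⟨ν, hν⟩ : N) = conjLeft N hN k⁻¹ ⟨η, hη⟩ := by
    refine eq_of_coeff_eq hN fun f hf => ?_
    obtain ⟨f', hf', hff'⟩ := h f hf
    rw [coeff_eq_of_actionMap_eq hregN hregM hff' (η := ⟨ν, hν⟩) (μ := μ') hν2,
      coeff_conjLeft hM hf', coeff_conjLeft hN hf,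
      coeff_eq_of_actionMap_eq hregN hregM hff' (η := ⟨η, hη⟩) (μ := ⟨μ, hμ⟩) hημ]
  have hν3 : ν = (conjLeft N hN k⁻¹ ⟨η, hη⟩ : N) := congrArg Subtype.val this
  rw [hν3] at hν2
  simpa [μ', coe_conjLeft, leftRegular] using hν2

/-- The underlying group of a Hopf-Galois structure is unique. -/
theorem HopfGaloisStructure.HasUnderlyingGroup.eq {S : HopfGaloisStructure F L}
    (hSN : S.HasUnderlyingGroup N) (hSM : S.HasUnderlyingGroup M) : N = M := by
  have key : ∀ {N M : Subgroup (Equiv.Perm Gal(L/F))}, S.HasUnderlyingGroup N →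
      S.HasUnderlyingGroup M → N ≤ M := by
    rintro N M ⟨hregN, hN, e, -, -, h⟩ ⟨hregM, hM, e', -, -, h'⟩
    refine le_of_actionMap_le hregN hN hregM hM fun f hf => ?_
    obtain ⟨s, hs⟩ := e.surjective ⟨f, hf⟩
    refine ⟨e' s, (e' s).2, LinearMap.ext fun x => ?_⟩
    rw [actionMap_apply, actionMap_apply, ← h', h, hs]
  exact le_antisymm (key hSN hSM) (key hSM hSN)

end Structures

/-! ### Automorphisms of `C₄ × C₂` -/

section C4C2

/-- The generator of order four of `C₄ × C₂`. -/
abbrev C4C2.a : C4C2 := (Multiplicative.ofAdd 1, 1)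

/-- The generator of order two of `C₄ × C₂`. -/
abbrev C4C2.b : C4C2 := (1, Multiplicative.ofAdd 1)

/-- The value at `x` of the endomorphism of `C₄ × C₂` that maps the generators to `p` and `q`. -/
def C4C2.endo (p q x : C4C2) : C4C2 :=
  p ^ (ZMod.val (Multiplicative.toAdd x.1)) * q ^ (ZMod.val (Multiplicative.toAdd x.2))

theorem C4C2.endo_eq {E : Type*} [FunLike E C4C2 C4C2] [MonoidHomClass E C4C2 C4C2] (f : E)
    (x : C4C2) : f x = C4C2.endo (f C4C2.a) (f C4C2.b) x := by
  have : ∀ x : C4C2, x = C4C2.endo C4C2.a C4C2.b x := by decide +kernel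
  conv_lhs => rw [this x, C4C2.endo, map_mul, map_pow, map_pow]
  rfl

-- The conditions on `(p, q)` say that it is the image of `(a, b)` under one of the eight
-- automorphisms. Coding automorphisms by such pairs makes the statement on
-- $Q_8\to\mathrm{Aut}(C_4\times C_2)$ a finite check.
set_option synthInstance.maxHeartbeats 400000 in
set_option synthInstance.maxSize 2000 in
theorem C4C2.decide_endo : ∀ p q : C4C2, (p ^ 2 ≠ 1 ∧ q ≠ 1 ∧ q ^ 2 = 1 ∧ q ≠ p ^ 2) →
    ∀ p' q' : C4C2, (p' ^ 2 ≠ 1 ∧ q' ≠ 1 ∧ q' ^ 2 = 1 ∧ q' ≠ p' ^ 2) →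
    (C4C2.endo p q p = C4C2.endo p' q' p' ∧ C4C2.endo p q q = C4C2.endo p' q' q' ∧
      C4C2.endo p q (C4C2.endo p' q' p) = p' ∧ C4C2.endo p q (C4C2.endo p' q' q) = q') →
    ((p = C4C2.a ∨ p = C4C2.a⁻¹) ∧ q = C4C2.b) ∨ ((p' = C4C2.a ∨ p' = C4C2.a⁻¹) ∧ q' = C4C2.b) ∨
      ((C4C2.endo p q p' = C4C2.a ∨ C4C2.endo p q p' = C4C2.a⁻¹) ∧
        C4C2.endo p q q' = C4C2.b) := by
  decide +kernel

theorem C4C2.aut_eq_one_or_inv {f : MulAut C4C2} (ha : f C4C2.a = C4C2.a ∨ f C4C2.a = C4C2.a⁻¹)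
    (hb : f C4C2.b = C4C2.b) : (∀ x, f x = x) ∨ ∀ x, f x = x⁻¹ := by
  rcases ha with ha | ha
  · left
    have : ∀ x : C4C2, C4C2.endo C4C2.a C4C2.b x = x := by decide +kernel
    intro x
    rw [C4C2.endo_eq f, ha, hb, this]
  · right
    have : ∀ x : C4C2, C4C2.endo C4C2.a⁻¹ C4C2.b x = x⁻¹ := by decide +kernel
    intro x
    rw [C4C2.endo_eq f, ha, hb, this]

/-- If two automorphisms of `C₄ × C₂` satisfy relations of the quaternion group, then one of
them, or their product, is the identity or inversion. -/
theorem exists_mulAut_eq_one_or_inv {N : Type*} [Group N] (ψ : N ≃* C4C2) (f g : MulAut N)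
    (h1 : f * f = g * g) (h2 : f * g * f = g) :
    ∃ h : MulAut N, (h = f ∨ h = g ∨ h = f * g) ∧ ((∀ x, h x = x) ∨ ∀ x, h x = x⁻¹) := by
  have main : ∀ f g : MulAut C4C2, f * f = g * g → f * g * f = g →
      ∃ h : MulAut C4C2, (h = f ∨ h = g ∨ h = f * g) ∧ ((∀ x, h x = x) ∨ ∀ x, h x = x⁻¹) := by
    intro f g h1 h2
    have gen : ∀ f : MulAut C4C2, (f C4C2.a) ^ 2 ≠ 1 ∧ f C4C2.b ≠ 1 ∧ (f C4C2.b) ^ 2 = 1 ∧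
        f C4C2.b ≠ (f C4C2.a) ^ 2 := by
      intro f
      simp only [← map_pow, ne_eq, EmbeddingLike.map_eq_one_iff, EmbeddingLike.apply_eq_iff_eq]
      decide +kernel
    have e1 : ∀ x, f (f x) = g (g x) := fun x => DFunLike.congr_fun h1 x
    have e2 : ∀ x, f (g (f x)) = g x := fun x => DFunLike.congr_fun h2 x
    have := C4C2.decide_endo _ _ (gen f) _ _ (gen g)
    simp only [← C4C2.endo_eq] at this
    rcases this ⟨e1 _, e1 _, e2 _, e2 _⟩ with ⟨h, h'⟩ | ⟨h, h'⟩ | ⟨h, h'⟩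
    · exact ⟨f, by simp, C4C2.aut_eq_one_or_inv h h'⟩
    · exact ⟨g, by simp, C4C2.aut_eq_one_or_inv h h'⟩
    · exact ⟨f * g, by simp, C4C2.aut_eq_one_or_inv h h'⟩
  obtain ⟨h, hh, hx⟩ := main (MulAut.congr ψ f) (MulAut.congr ψ g)
    (by rw [← map_mul, h1, map_mul]) (by rw [← map_mul, ← map_mul, h2])
  refine ⟨(MulAut.congr ψ).symm h, ?_, hx.imp (fun hx x => ?_) fun hx x => ?_⟩
  · simpa only [← map_mul, MulEquiv.symm_apply_eq] using hh
  · simp [MulAut.congr, hx]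
  · simp [MulAut.congr, hx]

/-- The squares in $C_4\times C_2$ form a group of order two. -/
theorem sq_eq_one_or_sq_eq_sq {N : Type*} [Group N] (ψ : N ≃* C4C2) {x : N} (hx : x ^ 2 ≠ 1)
    (y : N) : y ^ 2 = 1 ∨ y ^ 2 = x ^ 2 := by
  have : ∀ x y : C4C2, x ^ 2 ≠ 1 → y ^ 2 = 1 ∨ y ^ 2 = x ^ 2 := by decide +kernel
  have h := this (ψ x) (ψ y)
  simp only [← map_pow, ne_eq, EmbeddingLike.map_eq_one_iff, EmbeddingLike.apply_eq_iff_eq] at h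
  exact h hx

end C4C2

/-! ### Pairs of generators of the quaternion group -/

section Quaternion

variable {G : Type*} [Group G]

theorem quaternion_facts : ∀ s t : QuaternionGroup 2, s * t ≠ t * s →
    s ^ 2 = t ^ 2 ∧ s ^ 4 = 1 ∧ s ^ 2 ≠ 1 ∧ (∀ g, g * s * g⁻¹ = s ∨ g * s * g⁻¹ = s⁻¹) ∧
    (∀ g, g * s ^ 2 = s ^ 2 * g) ∧
    (∀ g, ∃ i : Fin 4, g = s ^ (i : ℕ) ∨ g = s ^ (i : ℕ) * t) ∧
    ∀ (x : ZMod 4) (y : ZMod 2), s ^ x.val * (s * t⁻¹) ^ y.val = 1 → x = 0 ∧ y = 0 := by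
  decide +kernel

/-- Two non-commuting elements of a group isomorphic to the quaternion group. -/
structure IsQuaternionPair (s t : G) : Prop where
  ne : s * t ≠ t * s
  card : Nat.card G = 8
  sq_eq : s ^ 2 = t ^ 2
  pow_four : s ^ 4 = 1
  sq_ne : s ^ 2 ≠ 1
  conj : ∀ g, g * s * g⁻¹ = s ∨ g * s * g⁻¹ = s⁻¹
  sq_central : ∀ g, g * s ^ 2 = s ^ 2 * g
  eq_pow : ∀ g, ∃ i : ℕ, g = s ^ i ∨ g = s ^ i * t
  eq_zero : ∀ (x : ZMod 4) (y : ZMod 2), s ^ x.val * (s * t⁻¹) ^ y.val = 1 → x = 0 ∧ y = 0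

theorem IsQuaternionPair.of_ne (φ : G ≃* QuaternionGroup 2) {s t : G} (h : s * t ≠ t * s) :
    IsQuaternionPair s t := by
  have hne : φ s * φ t ≠ φ t * φ s := by
    simpa only [← map_mul, ne_eq, EmbeddingLike.apply_eq_iff_eq] using h
  obtain ⟨h1, h2, h3, h4, h5, h6, h7⟩ := quaternion_facts _ _ hne
  refine ⟨h, ?_, ?_, ?_, ?_, fun g => ?_, fun g => ?_, fun g => ?_, fun x y hxy => ?_⟩
  · rw [Nat.card_congr φ.toEquiv, Nat.card_eq_fintype_card, QuaternionGroup.card]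
  · simpa only [← map_pow, EmbeddingLike.apply_eq_iff_eq] using h1
  · simpa only [← map_pow, EmbeddingLike.map_eq_one_iff] using h2
  · simpa only [← map_pow, ne_eq, EmbeddingLike.map_eq_one_iff] using h3
  · simpa only [← map_mul, ← map_inv, EmbeddingLike.apply_eq_iff_eq] using h4 (φ g)
  · simpa only [← map_mul, ← map_pow, EmbeddingLike.apply_eq_iff_eq] using h5 (φ g)
  · obtain ⟨i, hi⟩ := h6 (φ g)
    exact ⟨i, by simpa only [← map_mul, ← map_pow, EmbeddingLike.apply_eq_iff_eq] using hi⟩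
  · exact h7 x y (by
      simpa only [← map_mul, ← map_pow, ← map_inv, EmbeddingLike.map_eq_one_iff] using hxy)

@[simp]
theorem leftRegular_apply (g x : G) : leftRegular G g x = g * x := rfl

@[simp]
theorem rightRegular_apply (g x : G) : rightRegular G g x = x * g⁻¹ := rfl

theorem leftRegular_comm_rightRegular (g h : G) :
    leftRegular G g * rightRegular G h = rightRegular G h * leftRegular G g := by
  ext x; simp [mul_assoc]

theorem leftRegular_injective : Function.Injective (leftRegular G) := fun g h hgh => by
  simpa using DFunLike.congr_fun hgh 1

theorem rightRegular_injective : Function.Injective (rightRegular G) := fun g h hgh => by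
  simpa using DFunLike.congr_fun hgh 1

/-- A transitive commutative group of permutations is regular. -/
theorem isRegular_of_comm {N : Subgroup (Equiv.Perm G)} (hcomm : ∀ η ∈ N, ∀ μ ∈ N, η * μ = μ * η)
    (htrans : ∀ g : G, ∃ η ∈ N, η 1 = g) : IsRegular N := by
  have hfix : ∀ η ∈ N, ∀ g : G, η g = g → η = 1 := by
    intro η hη g hg
    ext h
    obtain ⟨μ, hμ, rfl⟩ := htrans g
    obtain ⟨ν, hν, rfl⟩ := htrans h
    -- An element of `N` carries `g` to `h` and commutes with `η`, so `η` fixes `h` too.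
    have e : (ν * μ⁻¹) (μ 1) = ν 1 := by simp
    have hνμ := N.mul_mem hν (N.inv_mem hμ)
    rw [Equiv.Perm.one_apply, ← e, ← Equiv.Perm.mul_apply, hcomm η hη _ hνμ, Equiv.Perm.mul_apply,
      hg]
  refine ⟨?_, hfix, fun g h => ?_⟩
  · refine Nat.card_congr (Equiv.ofBijective (fun η : N => (η : Equiv.Perm G) 1) ⟨?_, ?_⟩)
    · intro η μ h
      have := hfix ((μ : Equiv.Perm G)⁻¹ * η) (N.mul_mem (N.inv_mem μ.2) η.2) 1 (by
        rw [Equiv.Perm.mul_apply, show (η : Equiv.Perm G) 1 = (μ : Equiv.Perm G) 1 from h,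
          ← Equiv.Perm.mul_apply, inv_mul_cancel, Equiv.Perm.one_apply])
      exact Subtype.ext (inv_mul_eq_one.1 this).symm
    · intro g
      obtain ⟨η, hη, hg⟩ := htrans g
      exact ⟨⟨η, hη⟩, hg⟩
  · obtain ⟨μ, hμ, rfl⟩ := htrans g
    obtain ⟨ν, hν, rfl⟩ := htrans h
    exact ⟨ν * μ⁻¹, N.mul_mem hν (N.inv_mem hμ), by simp⟩

theorem leftRegular_mem_groupA (s t : G) : leftRegular G s ∈ groupA s t :=
  Subgroup.subset_closure (by simp)

theorem rightRegular_mem_groupA (s t : G) : rightRegular G t ∈ groupA s t :=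
  Subgroup.subset_closure (by simp)

theorem groupA_comm (s t : G) : ∀ η ∈ groupA s t, ∀ μ ∈ groupA s t, η * μ = μ * η := by
  intro η hη μ hμ
  have h := leftRegular_comm_rightRegular s t
  refine Subgroup.closure_induction₂ (p := fun x y _ _ => Commute x y) ?_ (fun _ _ => Commute.one_left _)
    (fun _ _ => Commute.one_right _) (fun _ _ _ _ _ _ h h' => h.mul_left h')
    (fun _ _ _ _ _ _ h h' => h.mul_right h') (fun _ _ _ _ h => h.inv_left)
    (fun _ _ _ _ h => h.inv_right) hη hμ
  rintro x y (rfl | rfl) (rfl | rfl)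
  · exact Commute.refl _
  · exact h
  · exact h.symm
  · exact Commute.refl _

/-- $\lambda(G)$ centralizes $\rho(t)$, and $\langle s\rangle$ is normal. -/
theorem isNormalizedByLeft_groupA {s t : G}
    (hconj : ∀ g, g * s * g⁻¹ = s ∨ g * s * g⁻¹ = s⁻¹) : IsNormalizedByLeft (groupA s t) := by
  have key : ∀ g, ∀ η ∈ groupA s t,
      leftRegular G g * η * (leftRegular G g)⁻¹ ∈ groupA s t := by
    intro g η hη
    induction hη using Subgroup.closure_induction with
    | mem x hx =>
      rcases hx with rfl | rfl
      · rw [← map_mul, ← map_inv, ← map_mul]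
        rcases hconj g with e | e <;> rw [e]
        · exact leftRegular_mem_groupA s t
        · rw [map_inv]; exact Subgroup.inv_mem _ (leftRegular_mem_groupA s t)
      · rw [leftRegular_comm_rightRegular, mul_inv_cancel_right]
        exact rightRegular_mem_groupA s t
    | one => simp
    | mul x y _ _ hx hy => simpa [mul_assoc] using Subgroup.mul_mem _ hx hy
    | inv x _ hx => simpa [mul_assoc] using Subgroup.inv_mem _ hx
  rintro _ ⟨g, rfl⟩
  rw [Subgroup.mem_normalizer_iff]
  refine fun η => ⟨key g η, fun hη => ?_⟩
  have := key g⁻¹ _ hη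
  simpa [mul_assoc] using this

namespace IsQuaternionPair

variable {s t : G} (h : IsQuaternionPair s t)
include h

theorem isRegular_groupA : IsRegular (groupA s t) := by
  refine isRegular_of_comm (groupA_comm s t) fun g => ?_
  have hs := (groupA s t).pow_mem (leftRegular_mem_groupA s t)
  obtain ⟨i, rfl | rfl⟩ := h.eq_pow g
  · exact ⟨_, hs i, by simp [← map_pow]⟩
  · exact ⟨_, (groupA s t).mul_mem (hs i) ((groupA s t).inv_mem (rightRegular_mem_groupA s t)),
      by simp [← map_pow, ← map_inv]⟩

theorem nonempty_mulEquiv : Nonempty (groupA s t ≃* C4C2) := by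
  let p : groupA s t := ⟨leftRegular G s, leftRegular_mem_groupA s t⟩
  -- $\rho(t)$ has order four; the complement of $\langle\lambda(s)\rangle$ is generated by
  -- $\lambda(s)\rho(t)$, an involution because $s^2=t^2$ is central.
  let q : groupA s t := p * ⟨rightRegular G t, rightRegular_mem_groupA s t⟩
  have hpq : Commute p q := Subtype.ext (groupA_comm s t _ p.2 _ q.2)
  have hp : p ^ 4 = 1 := Subtype.ext (by simp [p, ← map_pow, h.pow_four])
  have hq : q ^ 2 = 1 := by
    apply Subtype.ext
    ext x
    have e1 := h.sq_central x
    have e2 : s ^ 2 * t⁻¹ * t⁻¹ = 1 := by rw [h.sq_eq]; group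
    simp only [q, p, pow_two, Subgroup.coe_mul, Equiv.Perm.mul_apply, leftRegular_apply,
      rightRegular_apply, Subgroup.coe_one, Equiv.Perm.one_apply]
    rw [pow_two] at e1 e2
    calc s * (s * (x * t⁻¹) * t⁻¹) = (s * s * x) * t⁻¹ * t⁻¹ := by simp only [mul_assoc]
      _ = x * (s * s * t⁻¹ * t⁻¹) := by rw [← e1]; simp only [mul_assoc]
      _ = x := by rw [e2, mul_one]
  let f : C4C2 →* groupA s t := MonoidHom.mk'
    (fun x => p ^ (ZMod.val (Multiplicative.toAdd x.1)) * q ^ (ZMod.val (Multiplicative.toAdd x.2)))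
    (fun x y => by
      simp only [Prod.fst_mul, Prod.snd_mul, toAdd_mul, ZMod.val_add]
      rw [← pow_eq_pow_mod _ hp, ← pow_eq_pow_mod _ hq, pow_add, pow_add]
      exact (hpq.pow_pow _ _).mul_mul_mul_comm _ _)
  have hf : Function.Injective f := by
    rw [injective_iff_map_eq_one]
    rintro ⟨x, y⟩ hxy
    have e := DFunLike.congr_fun (congrArg Subtype.val hxy) (1 : G)
    have := h.eq_zero (Multiplicative.toAdd x) (Multiplicative.toAdd y) (by
      have hy : ∀ y : ZMod 2, ((q : Equiv.Perm G) ^ y.val) 1 = (s * t⁻¹) ^ y.val := by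
        intro y
        fin_cases y <;> simp [q, p, ZMod.val]
      rw [← hy, ← leftRegular_apply, map_pow]
      exact e)
    exact Prod.ext this.1 this.2
  have hcard : Nat.card C4C2 = Nat.card (groupA s t) := by
    rw [h.isRegular_groupA.card_eq, h.card]
    simp
  have : Finite G := Nat.finite_of_card_ne_zero (by rw [h.card]; norm_num)
  exact ⟨(MulEquiv.ofBijective f
    ((Nat.bijective_iff_injective_and_card f).2 ⟨hf, hcard⟩)).symm⟩

end IsQuaternionPair

end Quaternion

/-! ### Regular subgroups of type `C₄ × C₂` normalised by the quaternion group -/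

section Classification

variable {G : Type*} [Group G] {N : Subgroup (Equiv.Perm G)}

theorem conjLeft_apply (hN : IsNormalizedByLeft N) (g : G) (η : N) :
    (conjLeft N hN g η : Equiv.Perm G) = leftRegular G g * η * (leftRegular G g)⁻¹ := rfl

theorem conjLeft_mul (hN : IsNormalizedByLeft N) (g h : G) :
    (conjLeft N hN (g * h) : MulAut N) = (conjLeft N hN g : MulAut N) * conjLeft N hN h := by
  ext η x
  simp [conjLeft_apply]

/-- Conjugation by `λ(g)` can only act as inversion if `g² = 1`. -/
theorem sq_eq_one_of_conjLeft_eq_inv (hreg : IsRegular N) (hN : IsNormalizedByLeft N) {g : G}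
    (h : ∀ η : N, conjLeft N hN g η = η⁻¹) : g ^ 2 = 1 := by
  obtain ⟨η, hη, hg⟩ := hreg.transitive 1 g
  -- At `g = η 1`, the relation $\lambda(g)\eta\lambda(g)^{-1}=\eta^{-1}$ reads $g\cdot g=1$.
  have e := DFunLike.congr_fun (congrArg Subtype.val (h ⟨η, hη⟩)) g
  rw [conjLeft_apply, ← map_inv] at e
  simp only [Equiv.Perm.mul_apply, leftRegular_apply, inv_mul_cancel, hg, Subgroup.coe_inv] at e
  rw [pow_two, e, Equiv.Perm.inv_eq_iff_eq, hg]

/-- If `λ(g)` centralises a regular commutative group, it is contained in it. -/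
theorem leftRegular_mem_of_conjLeft_eq (hreg : IsRegular N) (hN : IsNormalizedByLeft N)
    (hcomm : ∀ η ∈ N, ∀ μ ∈ N, η * μ = μ * η) {g : G}
    (h : ∀ η : N, conjLeft N hN g η = η) : leftRegular G g ∈ N := by
  obtain ⟨η, hη, hg⟩ := hreg.transitive 1 g
  suffices e : leftRegular G g = η by rwa [e]
  ext x
  obtain ⟨μ, hμ, rfl⟩ := hreg.transitive 1 x
  have e : leftRegular G g * μ = μ * leftRegular G g :=
    mul_inv_eq_iff_eq_mul.1 (congrArg Subtype.val (h ⟨μ, hμ⟩))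
  rw [← Equiv.Perm.mul_apply, e, ← Equiv.Perm.mul_apply, hcomm η hη μ hμ, Equiv.Perm.mul_apply,
    Equiv.Perm.mul_apply, hg, leftRegular_apply, mul_one]

/-- Commuting with $\lambda(s)$, $\eta$ is determined by its values at $1$ and $t$. These are $t$
and $\eta^2[1]=s^2=t^2$, as for right multiplication by $t$, which is $\rho(t)^{-1}$. -/
theorem rightRegular_mem_of_sq_eq (hcomm : ∀ η ∈ N, ∀ μ ∈ N, η * μ = μ * η) {s t : G}
    (h : IsQuaternionPair s t) (hs : leftRegular G s ∈ N) {η : Equiv.Perm G} (hη : η ∈ N)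
    (hη1 : η 1 = t) (hη2 : η ^ 2 = leftRegular G s ^ 2) : rightRegular G t ∈ N := by
  suffices e : rightRegular G t = η⁻¹ by rw [e]; exact N.inv_mem hη
  rw [eq_inv_iff_mul_eq_one, mul_eq_one_iff_inv_eq, ← map_inv]
  have hpow : ∀ (i : ℕ) (x : G), η (s ^ i * x) = s ^ i * η x := by
    intro i x
    rw [← leftRegular_apply, ← leftRegular_apply, map_pow, ← Equiv.Perm.mul_apply,
      hcomm η hη _ (N.pow_mem hs i), Equiv.Perm.mul_apply]
  have hηt : η t = t * t := by
    have e := DFunLike.congr_fun hη2 1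
    rwa [← map_pow, leftRegular_apply, mul_one, h.sq_eq, pow_two, pow_two, Equiv.Perm.mul_apply,
      hη1] at e
  ext x
  rw [rightRegular_apply, inv_inv]
  obtain ⟨i, rfl | rfl⟩ := h.eq_pow x
  · have := hpow i 1
    rw [mul_one, hη1] at this
    exact this.symm
  · rw [hpow, hηt, mul_assoc]

/-- Take $\eta\in N$ with $\eta[1]=t$. If $\eta^2=\lambda(s)^2$, the previous lemma applies to
$\eta$; otherwise $\eta^2=1$, and it applies to $\lambda(s)\eta$, which sends $1$ to $st$. -/
theorem rightRegular_mem_or (hreg : IsRegular N) (ψ : N ≃* C4C2)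
    (hcomm : ∀ η ∈ N, ∀ μ ∈ N, η * μ = μ * η) {s t : G} (h : IsQuaternionPair s t)
    (h' : IsQuaternionPair s (s * t)) (hs : leftRegular G s ∈ N) :
    rightRegular G t ∈ N ∨ rightRegular G (s * t) ∈ N := by
  obtain ⟨η, hη, hη1⟩ := hreg.transitive 1 t
  have hsq : (⟨leftRegular G s, hs⟩ : N) ^ 2 ≠ 1 := by
    intro e
    have e' := congrArg Subtype.val e
    simp only [Subgroup.coe_pow, Subgroup.coe_one, ← map_pow] at e'
    exact h.sq_ne (leftRegular_injective (e'.trans (map_one _).symm))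
  rcases sq_eq_one_or_sq_eq_sq ψ hsq ⟨η, hη⟩ with e | e
  · right
    refine rightRegular_mem_of_sq_eq hcomm h' hs (N.mul_mem hs hη) ?_ ?_
    · rw [Equiv.Perm.mul_apply, hη1, leftRegular_apply]
    · rw [Commute.mul_pow (hcomm _ hs _ hη),
        show η ^ 2 = 1 from congrArg Subtype.val e, mul_one]
  · left
    exact rightRegular_mem_of_sq_eq hcomm h hs hη hη1 (congrArg Subtype.val e)

/-- Distinct elements of `{σ, τ, στ}` do not commute. -/
theorem mul_ne_mul_of_mem {σ τ : G} (hne : σ * τ ≠ τ * σ) {s t : G}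
    (hs : s ∈ ({σ, τ, σ * τ} : Set G)) (ht : t ∈ ({σ, τ, σ * τ} : Set G)) (hst : s ≠ t) :
    s * t ≠ t * s := by
  rcases hs with rfl | rfl | rfl <;> rcases ht with rfl | rfl | rfl
  · exact absurd rfl hst
  · exact hne
  · simpa [mul_assoc] using hne
  · exact hne.symm
  · exact absurd rfl hst
  · simpa [← mul_assoc] using hne.symm
  · simpa [mul_assoc] using hne.symm
  · simpa [← mul_assoc] using hne
  · exact absurd rfl hst

/-- The inverse is harmless in the application, since a subgroup contains $\rho(r)$ exactly when it
contains $\rho(r^{-1})$. -/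
theorem exists_mul_eq {σ τ : G} (hne : σ * τ ≠ τ * σ) (hσ : σ ^ 4 = 1) (hστ : σ ^ 2 = τ ^ 2)
    (hcomm : σ * τ = τ * σ⁻¹) {s : G} (hs : s ∈ ({σ, τ, σ * τ} : Set G)) :
    ∃ t ∈ ({σ, τ, σ * τ} : Set G), ∃ r ∈ ({σ, τ, σ * τ} : Set G), s ≠ t ∧ s ≠ r ∧
      (s * t = r ∨ s * t = r⁻¹) := by
  have h1 : σ ≠ τ := by rintro rfl; exact hne rfl
  have h2 : σ ≠ σ * τ := by
    intro h; exact hne (by rw [left_eq_mul.1 h, mul_one, one_mul])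
  have h3 : τ ≠ σ * τ := by
    intro h; exact hne (by rw [right_eq_mul.1 h, mul_one, one_mul])
  rcases hs with rfl | rfl | rfl
  · exact ⟨τ, by simp, s * τ, by simp, h1, h2, Or.inl rfl⟩
  · refine ⟨σ, by simp, σ * s, by simp, h1.symm, h3, Or.inr ?_⟩
    rw [eq_inv_iff_mul_eq_one]
    calc s * σ * (σ * s) = s * σ ^ 2 * s := by simp only [pow_two, mul_assoc]
      _ = σ ^ 4 := by
        rw [show (4 : ℕ) = 2 + 2 from rfl, pow_add, hστ]; simp only [pow_two, mul_assoc]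
      _ = 1 := hσ
  · refine ⟨σ, by simp, τ, by simp, h2.symm, h3.symm, Or.inl ?_⟩
    rw [hcomm, inv_mul_cancel_right]

/-- The regular subgroups of type `C₄ × C₂` normalised by `λ(G)` are the groups `A_{s,t}`. -/
theorem exists_eq_groupA (φ : G ≃* QuaternionGroup 2) {σ τ : G} (hne : σ * τ ≠ τ * σ)
    (hσ : σ ^ 4 = 1) (hστ : σ ^ 2 = τ ^ 2) (hcomm : σ * τ = τ * σ⁻¹) (hreg : IsRegular N)
    (hN : IsNormalizedByLeft N) (ψ : N ≃* C4C2) :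
    ∃ s ∈ ({σ, τ, σ * τ} : Set G), ∃ t ∈ ({σ, τ, σ * τ} : Set G), s ≠ t ∧ N = groupA s t := by
  have hNcomm : ∀ η ∈ N, ∀ μ ∈ N, η * μ = μ * η := fun η hη μ hμ =>
    congrArg Subtype.val (ψ.injective (by rw [map_mul, map_mul, mul_comm]) :
      (⟨η, hη⟩ * ⟨μ, hμ⟩ : N) = ⟨μ, hμ⟩ * ⟨η, hη⟩)
  obtain ⟨f, hf, hf'⟩ := exists_mulAut_eq_one_or_inv ψ (conjLeft N hN σ) (conjLeft N hN τ)
    (by rw [← conjLeft_mul, ← conjLeft_mul, ← pow_two, hστ, pow_two])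
    (by rw [← conjLeft_mul, ← conjLeft_mul, hcomm, inv_mul_cancel_right])
  obtain ⟨s, hs, rfl⟩ : ∃ s ∈ ({σ, τ, σ * τ} : Set G), f = conjLeft N hN s := by
    rw [← conjLeft_mul] at hf
    rcases hf with rfl | rfl | rfl
    · exact ⟨σ, by simp, rfl⟩
    · exact ⟨τ, by simp, rfl⟩
    · exact ⟨σ * τ, by simp, rfl⟩
  obtain ⟨t, ht, r, hr, hst, hsr, hstr⟩ := exists_mul_eq hne hσ hστ hcomm hs
  have hpair := IsQuaternionPair.of_ne φ (mul_ne_mul_of_mem hne hs ht hst)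
  have hpair' : IsQuaternionPair s (s * t) := IsQuaternionPair.of_ne φ (by
    simpa [mul_assoc] using mul_ne_mul_of_mem hne hs ht hst)
  have hsN : leftRegular G s ∈ N := by
    rcases hf' with hf' | hf'
    · exact leftRegular_mem_of_conjLeft_eq hreg hN hNcomm hf'
    · exact absurd (sq_eq_one_of_conjLeft_eq_inv hreg hN hf') hpair.sq_ne
  have key : ∃ t ∈ ({σ, τ, σ * τ} : Set G), s ≠ t ∧ rightRegular G t ∈ N := by
    rcases rightRegular_mem_or hreg ψ hNcomm hpair hpair' hsN with h | h
    · exact ⟨t, ht, hst, h⟩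
    · refine ⟨r, hr, hsr, ?_⟩
      rcases hstr with e | e
      · rwa [e] at h
      · rwa [e, map_inv, inv_mem_iff] at h
  obtain ⟨t', ht', hst', htN⟩ := key
  refine ⟨s, hs, t', ht', hst', ?_⟩
  have : Finite G := Nat.finite_of_card_ne_zero (by rw [hpair.card]; norm_num)
  refine (Subgroup.eq_of_le_of_card_ge ?_ ?_).symm
  · rw [groupA, Subgroup.closure_le]
    rintro _ (rfl | rfl)
    · exact hsN
    · exact htN
  · rw [hreg.card_eq,
      (IsQuaternionPair.of_ne φ (mul_ne_mul_of_mem hne hs ht' hst')).isRegular_groupA.card_eq]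

/-- $A_{s',t'}$ is abelian while distinct members of $\{\sigma,\tau,\sigma\tau\}$ do not commute, so
it contains $\lambda(s)$ only for $s=s'$ and $\rho(t)$ only for $t=t'$. -/
theorem groupA_injOn {σ τ : G} (hne : σ * τ ≠ τ * σ) {s t s' t' : G}
    (hs : s ∈ ({σ, τ, σ * τ} : Set G)) (ht : t ∈ ({σ, τ, σ * τ} : Set G))
    (hs' : s' ∈ ({σ, τ, σ * τ} : Set G)) (ht' : t' ∈ ({σ, τ, σ * τ} : Set G))
    (h : groupA s t = groupA s' t') : s = s' ∧ t = t' := by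
  have h1 : leftRegular G s ∈ groupA s' t' := h ▸ leftRegular_mem_groupA s t
  have h2 : rightRegular G t ∈ groupA s' t' := h ▸ rightRegular_mem_groupA s t
  constructor
  · by_contra hss
    refine mul_ne_mul_of_mem hne hs hs' hss (leftRegular_injective ?_)
    rw [map_mul, map_mul, groupA_comm s' t' _ h1 _ (leftRegular_mem_groupA s' t')]
  · by_contra htt
    refine mul_ne_mul_of_mem hne ht ht' htt (rightRegular_injective ?_)
    rw [map_mul, map_mul, groupA_comm s' t' _ h2 _ (rightRegular_mem_groupA s' t')]

theorem mul_ne_mul_of_closure_eq_top (φ : G ≃* QuaternionGroup 2) {σ τ : G}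
    (hgen : Subgroup.closure {σ, τ} = ⊤) : σ * τ ≠ τ * σ := by
  intro h
  have hcomm : ∀ x y : G, Commute x y := by
    intro x y
    have hx : x ∈ Subgroup.closure {σ, τ} := hgen ▸ Subgroup.mem_top x
    have hy : y ∈ Subgroup.closure {σ, τ} := hgen ▸ Subgroup.mem_top y
    refine Subgroup.closure_induction₂ (p := fun x y _ _ => Commute x y) ?_
      (fun _ _ => Commute.one_left _) (fun _ _ => Commute.one_right _)
      (fun _ _ _ _ _ _ h h' => h.mul_left h') (fun _ _ _ _ _ _ h h' => h.mul_right h')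
      (fun _ _ _ _ h => h.inv_left) (fun _ _ _ _ h => h.inv_right) hx hy
    rintro x y (rfl | rfl) (rfl | rfl)
    · exact Commute.refl _
    · exact h
    · exact h.symm
    · exact Commute.refl _
  have : ∃ x y : QuaternionGroup 2, x * y ≠ y * x := by decide
  obtain ⟨x, y, hxy⟩ := this
  apply hxy
  have := congrArg φ (hcomm (φ.symm x) (φ.symm y)).eq
  simpa using this

theorem ncard_pairs {σ τ : G} (hne : σ * τ ≠ τ * σ) :
    {p : G × G | p.1 ∈ ({σ, τ, σ * τ} : Set G) ∧ p.2 ∈ ({σ, τ, σ * τ} : Set G) ∧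
      p.1 ≠ p.2}.ncard = 6 := by
  classical
  have h1 : σ ≠ τ := by rintro rfl; exact hne rfl
  have h2 : σ ≠ σ * τ := by
    intro h; exact hne (by rw [left_eq_mul.1 h, mul_one, one_mul])
  have h3 : τ ≠ σ * τ := by
    intro h; exact hne (by rw [right_eq_mul.1 h, mul_one, one_mul])
  have : {p : G × G | p.1 ∈ ({σ, τ, σ * τ} : Set G) ∧ p.2 ∈ ({σ, τ, σ * τ} : Set G) ∧
      p.1 ≠ p.2} = (({σ, τ, σ * τ} : Finset G).offDiag : Set (G × G)) := by
    ext p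
    simp
  rw [this, Set.ncard_coe_finset, Finset.offDiag_card, Finset.card_eq_three.2
    ⟨_, _, _, h1, h2, h3, rfl⟩]

end Classification

end HopfGalois

end

theorem mainTheorem3 {F : Type u} {L : Type v} [Field F] [Field L] [Algebra F L]
    [FiniteDimensional F L] [IsGalois F L]
    (hG : Nonempty (Gal(L/F) ≃* QuaternionGroup 2))
    (σ τ : Gal(L/F)) (hgen : Subgroup.closure {σ, τ} = ⊤)
    (hσ : σ ^ 4 = 1) (hτ : τ ^ 4 = 1) (hστ : σ ^ 2 = τ ^ 2) (hcomm : σ * τ = τ * σ⁻¹)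
    (X : Set Gal(L/F)) (hX : X = {σ, τ, σ * τ}) :
    -- each `A_{s,t}` is regular, normalised by `λ(G)`, and isomorphic to `C₄ × C₂`
    (∀ s ∈ X, ∀ t ∈ X, s ≠ t →
      HopfGalois.IsRegular (HopfGalois.groupA s t) ∧
      HopfGalois.IsNormalizedByLeft (HopfGalois.groupA s t) ∧
      Nonempty (HopfGalois.groupA s t ≃* HopfGalois.C4C2)) ∧
    -- there are six pairs, and they give six distinct groups
    {p : Gal(L/F) × Gal(L/F) | p.1 ∈ X ∧ p.2 ∈ X ∧ p.1 ≠ p.2}.ncard = 6 ∧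
    Set.InjOn (fun p : Gal(L/F) × Gal(L/F) => HopfGalois.groupA p.1 p.2)
      {p : Gal(L/F) × Gal(L/F) | p.1 ∈ X ∧ p.2 ∈ X ∧ p.1 ≠ p.2} ∧
    -- up to isomorphism, there are exactly six structures of type `C₄ × C₂` on `L/F`
    {c : Quotient (HopfGalois.HopfGaloisStructure.setoid (F := F) (L := L)) |
      ∃ S : HopfGalois.HopfGaloisStructure F L, S.IsOfType HopfGalois.C4C2 ∧ ⟦S⟧ = c}.ncard = 6 ∧
    -- each of them has exactly one underlying group, which is one of the `A_{s,t}`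
    (∀ S : HopfGalois.HopfGaloisStructure F L, S.IsOfType HopfGalois.C4C2 →
      ∃ s ∈ X, ∃ t ∈ X, s ≠ t ∧
        ∀ N : Subgroup (Equiv.Perm Gal(L/F)),
          S.HasUnderlyingGroup N ↔ N = HopfGalois.groupA s t) ∧
    -- each `A_{s,t}` is the underlying group of exactly one of them, up to isomorphism
    (∀ s ∈ X, ∀ t ∈ X, s ≠ t →
      ∃ S : HopfGalois.HopfGaloisStructure F L, S.IsOfType HopfGalois.C4C2 ∧
        ∀ S' : HopfGalois.HopfGaloisStructure F L,
          S'.HasUnderlyingGroup (HopfGalois.groupA s t) ↔ S'.Equivalent S) := by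

  obtain ⟨φ⟩ := hG
  subst hX
  have hne := HopfGalois.mul_ne_mul_of_closure_eq_top φ hgen
  have hA : ∀ s ∈ ({σ, τ, σ * τ} : Set Gal(L/F)), ∀ t ∈ ({σ, τ, σ * τ} : Set Gal(L/F)), s ≠ t →
      HopfGalois.IsRegular (HopfGalois.groupA s t) ∧
      HopfGalois.IsNormalizedByLeft (HopfGalois.groupA s t) ∧
      Nonempty (HopfGalois.groupA s t ≃* HopfGalois.C4C2) := by
    intro s hs t ht hst
    have h := HopfGalois.IsQuaternionPair.of_ne φ (HopfGalois.mul_ne_mul_of_mem hne hs ht hst)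
    exact ⟨h.isRegular_groupA, HopfGalois.isNormalizedByLeft_groupA h.conj, h.nonempty_mulEquiv⟩
  have hinj : Set.InjOn (fun p : Gal(L/F) × Gal(L/F) => HopfGalois.groupA p.1 p.2)
      {p : Gal(L/F) × Gal(L/F) | p.1 ∈ ({σ, τ, σ * τ} : Set Gal(L/F)) ∧
        p.2 ∈ ({σ, τ, σ * τ} : Set Gal(L/F)) ∧ p.1 ≠ p.2} := by
    rintro ⟨s, t⟩ ⟨hs, ht, -⟩ ⟨s', t'⟩ ⟨hs', ht', -⟩ h
    obtain ⟨rfl, rfl⟩ := HopfGalois.groupA_injOn hne hs ht hs' ht' h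
    rfl
  have hex : ∀ S : HopfGalois.HopfGaloisStructure F L, S.IsOfType HopfGalois.C4C2 →
      ∃ s ∈ ({σ, τ, σ * τ} : Set Gal(L/F)), ∃ t ∈ ({σ, τ, σ * τ} : Set Gal(L/F)), s ≠ t ∧
        S.HasUnderlyingGroup (HopfGalois.groupA s t) := by
    rintro S ⟨N, hSN, ⟨ψ⟩⟩
    obtain ⟨s, hs, t, ht, hst, rfl⟩ :=
      HopfGalois.exists_eq_groupA φ hne hσ hστ hcomm hSN.1 hSN.2.choose ψ
    exact ⟨s, hs, t, ht, hst, hSN⟩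
  have hstr : ∀ s ∈ ({σ, τ, σ * τ} : Set Gal(L/F)), ∀ t ∈ ({σ, τ, σ * τ} : Set Gal(L/F)), s ≠ t →
      ∃ S : HopfGalois.HopfGaloisStructure F L,
        S.HasUnderlyingGroup (HopfGalois.groupA s t) ∧ S.IsOfType HopfGalois.C4C2 := by
    intro s hs t ht hst
    obtain ⟨hreg, hN, hψ⟩ := hA s hs t ht hst
    have := HopfGalois.hasUnderlyingGroup_structureOf hreg hN
    exact ⟨_, this, _, this, hψ⟩
  refine ⟨hA, HopfGalois.ncard_pairs hne, hinj, ?_, ?_, ?_⟩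
  · rw [← HopfGalois.ncard_pairs hne]
    symm
    -- A pair goes to the class of a structure with underlying group $A_{s,t}$: injective since that
    -- group is unique, surjective since it determines the structure.
    refine Set.ncard_congr (fun p hp => ⟦(hstr p.1 hp.1 p.2 hp.2.1 hp.2.2).choose⟧) ?_ ?_ ?_
    · exact fun p hp => ⟨_, (hstr p.1 hp.1 p.2 hp.2.1 hp.2.2).choose_spec.2, rfl⟩
    · intro p q hp hq hpq
      have e := Quotient.exact hpq
      exact hinj hp hq (((hstr p.1 hp.1 p.2 hp.2.1 hp.2.2).choose_spec.1.congr e).eq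
        (hstr q.1 hq.1 q.2 hq.2.1 hq.2.2).choose_spec.1)
    · rintro c ⟨S, hS, rfl⟩
      obtain ⟨s, hs, t, ht, hst, hSA⟩ := hex S hS
      exact ⟨(s, t), ⟨hs, ht, hst⟩,
        Quotient.sound ((hstr s hs t ht hst).choose_spec.1.equivalent hSA)⟩
  · intro S hS
    obtain ⟨s, hs, t, ht, hst, hSA⟩ := hex S hS
    exact ⟨s, hs, t, ht, hst, fun N => ⟨fun h => h.eq hSA, fun h => h ▸ hSA⟩⟩
  · intro s hs t ht hst
    obtain ⟨S, hSA, hS⟩ := hstr s hs t ht hst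
    exact ⟨S, hS, fun S' => ⟨fun h => h.equivalent hSA,
      fun h => hSA.congr (HopfGalois.HopfGaloisStructure.setoid.iseqv.symm h)⟩⟩
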